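/- Let $K$ be a field and let $A=\bigoplus_{i\ge 0}A_i$ be a graded $K$-algebra which is connected, i.e. $A_0$ has basis $1_A$. Let $\varepsilon:A\to K$ be the standard augmentation ($1_A\mapsto 1$, $A_i\mapsto 0$ for $i>0$); through $\varepsilon$, $K$ is a left and a right $A$-module. A left (or right) module over a ring is of type $FP_n$ ($n\ge 0$) if it has a partial resolution $0\leftarrow M\leftarrow P_0\leftarrow\cdots\leftarrow P_n$ (exact at $M,P_0,\dots,P_{n-1}$) by finitely generated free modules; an $(A,A)$-bimodule (with $K$ acting in the same way on both sides) is of type $FP_n$ if it has such a partial resolution by finitely generated free bimodules, i.e. finite direct sums of copies of $A\otimes_K A$ with action $a(u\otimes v)b=au\otimes vb$. A graded $(A,A)$-bimodule $M=\bigoplus_{j\ge 0}M_j$ (with $A_iM_j\subseteq M_{i+j}$ and $M_jA_i\subseteq M_{i+j}$) is of type $FP_n$ in the graded sense if the free bimodules in such a resolution can be taken graded, with homogeneous bases, and the maps homogeneous of degree $0$. Let $M$ be a graded $(A,A)$-bimodule and let $n\ge 0$. (i) If $M$ is free as a right $A$-module and the left $A$-module $M\otimes_A K$ is of type $FP_n$,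 then the bimodule $M$ is of type $FP_n$, and also of type $FP_n$ in the graded sense. (ii) If $M$ is free as a left $A$-module and the right $A$-module $K\otimes_A M$ is of type $FP_n$, then the bimodule $M$ is of type $FP_n$, and also of type $FP_n$ in the graded sense. -/

import Mathlib

open scoped TensorProduct
open MulOpposite

/-! Left `A`-modules are `Module A M`, right `A`-modules are `Module Aᵐᵒᵖ M` (with `m * b` written
`op b • m`), and `(A, A)`-bimodules carry both structures together with
`SMulCommClass A Aᵐᵒᵖ M`. -/

/-- A `R`-module `M` (a left `A`-module if `R = A`, a right `A`-module if `R = Aᵐᵒᵖ`) is of type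
`FP_n` if there is a partial resolution `0 ← M ← P 0 ← P 1 ← ⋯ ← P n` by finitely generated free
modules `P i = R ^ (r i)`; the data beyond index `n` are irrelevant. -/
def IsFP (R : Type*) [Ring R] (M : Type*) [AddCommGroup M] [Module R M] (n : ℕ) : Prop :=
  ∃ (r : ℕ → ℕ) (e : (Fin (r 0) → R) →ₗ[R] M)
    (d : ∀ i : ℕ, (Fin (r (i + 1)) → R) →ₗ[R] (Fin (r i) → R)),
    Function.Surjective e ∧
    (0 < n → Function.Exact (d 0) e) ∧
    ∀ i : ℕ, i + 1 < n → Function.Exact (d (i + 1)) (d i)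

section Bimodules

/-- Homomorphisms of `(A, A)`-bimodules. -/
def IsBimoduleHom (A : Type*) [Ring A] {X Y : Type*} [AddCommGroup X] [AddCommGroup Y]
    [Module A X] [Module Aᵐᵒᵖ X] [Module A Y] [Module Aᵐᵒᵖ Y] (f : X →+ Y) : Prop :=
  (∀ (a : A) (x : X), f (a • x) = a • f x) ∧ ∀ (b : A) (x : X), f (op b • x) = op b • f x

/-- The free `(A, A)`-bimodule of rank one, `A ⊗[K] A` with the outer actions
`a (u ⊗ v) b = (a u) ⊗ (v b)`. (A type synonym, since Mathlib lets `Aᵐᵒᵖ` act on the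
left tensor factor.) -/
def OuterTensor (K A : Type*) [Field K] [Ring A] [Algebra K A] : Type _ := A ⊗[K] A

variable (K A : Type*) [Field K] [Ring A] [Algebra K A]

noncomputable instance : AddCommGroup (OuterTensor K A) :=
  inferInstanceAs (AddCommGroup (A ⊗[K] A))

noncomputable instance : Module K (OuterTensor K A) :=
  inferInstanceAs (Module K (A ⊗[K] A))

/-- The element `u ⊗ v` of the free bimodule of rank one. -/
noncomputable def OuterTensor.tmul (u v : A) : OuterTensor K A := (u ⊗ₜ[K] v : A ⊗[K] A)

/-- The left action `a (u ⊗ v) = (a u) ⊗ v`. -/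
noncomputable instance OuterTensor.leftModule : Module A (OuterTensor K A) :=
  Module.compHom (A ⊗[K] A)
    ((Module.End.rTensorAlgHom K A A).comp (Algebra.lsmul K K A : A →ₐ[K] _)).toRingHom

/-- The right action `(u ⊗ v) b = u ⊗ (v b)`. -/
noncomputable instance OuterTensor.rightModule : Module Aᵐᵒᵖ (OuterTensor K A) :=
  Module.compHom (A ⊗[K] A)
    ((Module.End.lTensorAlgHom K A A).comp (Algebra.lsmul K K A : Aᵐᵒᵖ →ₐ[K] _)).toRingHom

theorem OuterTensor.smul_tmul (a u v : A) :
    a • OuterTensor.tmul K A u v = OuterTensor.tmul K A (a * u) v := rfl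

theorem OuterTensor.op_smul_tmul (b u v : A) :
    op b • OuterTensor.tmul K A u v = OuterTensor.tmul K A u (v * b) := rfl

theorem OuterTensor.induction {P : OuterTensor K A → Prop} (h0 : P 0)
    (ht : ∀ u v, P (OuterTensor.tmul K A u v)) (ha : ∀ s t, P s → P t → P (s + t))
    (t : OuterTensor K A) : P t :=
  TensorProduct.induction_on (motive := P) t h0 ht ha

instance : SMulCommClass A Aᵐᵒᵖ (OuterTensor K A) where
  smul_comm a b t := by
    refine OuterTensor.induction K A (P := fun t => a • b • t = b • a • t) ?_ ?_ ?_ t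
    · simp
    · intro u v; rfl
    · intro s t hs ht; simp [hs, ht]

/-- An `(A, A)`-bimodule `M` is of type (bi-)`FP_n` if there is a partial resolution
`0 ← M ← F 0 ← F 1 ← ⋯ ← F n` by finitely generated free `(A, A)`-bimodules
`F i = (A ⊗[K] A) ^ (r i)`. -/
def IsBiFP (M : Type*) [AddCommGroup M] [Module A M] [Module Aᵐᵒᵖ M] (n : ℕ) : Prop :=
  ∃ (r : ℕ → ℕ) (e : (Fin (r 0) → OuterTensor K A) →+ M)
    (d : ∀ i : ℕ, (Fin (r (i + 1)) → OuterTensor K A) →+ (Fin (r i) → OuterTensor K A)),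
    IsBimoduleHom A e ∧ (∀ i : ℕ, IsBimoduleHom A (d i)) ∧
    Function.Surjective e ∧
    (0 < n → Function.Exact (d 0) e) ∧
    ∀ i : ℕ, i + 1 < n → Function.Exact (d (i + 1)) (d i)

end Bimodules

section Balanced

variable (A : Type*) [Ring A] (X Y : Type*) [AddCommGroup X] [AddCommGroup Y]

/-- The relations `(x a) ⊗ y = x ⊗ (a y)`. -/
def balancedRel [Module Aᵐᵒᵖ X] [Module A Y] : AddSubgroup (X ⊗[ℤ] Y) :=
  AddSubgroup.closure {t | ∃ (x : X) (a : A) (y : Y), t = (op a • x) ⊗ₜ[ℤ] y - x ⊗ₜ[ℤ] (a • y)}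

/-- The tensor product `X ⊗_A Y` of a right `A`-module `X` and a left `A`-module `Y` over a
ring `A` that need not be commutative. -/
def BalTensor [Module Aᵐᵒᵖ X] [Module A Y] : Type _ := (X ⊗[ℤ] Y) ⧸ balancedRel A X Y

namespace BalTensor

noncomputable instance [Module Aᵐᵒᵖ X] [Module A Y] : AddCommGroup (BalTensor A X Y) :=
  inferInstanceAs (AddCommGroup ((X ⊗[ℤ] Y) ⧸ balancedRel A X Y))

variable {X Y}

/-- The class of `x ⊗ y` in `X ⊗_A Y`. -/
noncomputable def tmul [Module Aᵐᵒᵖ X] [Module A Y] (x : X) (y : Y) : BalTensor A X Y :=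
  QuotientAddGroup.mk' (balancedRel A X Y) (x ⊗ₜ[ℤ] y)

theorem smul_tmul [Module Aᵐᵒᵖ X] [Module A Y] (x : X) (a : A) (y : Y) :
    tmul A (op a • x) y = tmul A x (a • y) :=
  (QuotientAddGroup.eq_iff_sub_mem).2 (AddSubgroup.subset_closure ⟨x, a, y, rfl⟩)

theorem hom_ext [Module Aᵐᵒᵖ X] [Module A Y] {Z : Type*} [AddCommGroup Z]
    {f g : BalTensor A X Y →+ Z} (h : ∀ x y, f (tmul A x y) = g (tmul A x y)) : f = g := by
  ext t
  obtain ⟨t, rfl⟩ := QuotientAddGroup.mk'_surjective (balancedRel A X Y) t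
  induction t with
  | zero => rw [map_zero]; exact (map_zero f).trans (map_zero g).symm
  | tmul x y => exact h x y
  | add s t hs ht =>
    rw [map_add]
    exact (map_add f _ _).trans ((congrArg₂ (· + ·) hs ht).trans (map_add g _ _).symm)

/-- For an `(A, A)`-bimodule `X`, left multiplication by `a` on `X ⊗_A Y`. -/
noncomputable def lact [Module A X] [Module Aᵐᵒᵖ X] [SMulCommClass A Aᵐᵒᵖ X] [Module A Y]
    (a : A) : BalTensor A X Y →+ BalTensor A X Y :=
  QuotientAddGroup.map (balancedRel A X Y) (balancedRel A X Y)
    (TensorProduct.map (DistribSMul.toAddMonoidHom X a).toIntLinearMap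
      LinearMap.id).toAddMonoidHom (by
      refine (AddSubgroup.closure_le _).2 ?_
      rintro _ ⟨x, b, y, rfl⟩
      refine AddSubgroup.subset_closure ⟨a • x, b, y, ?_⟩
      exact (map_sub _ _ _).trans (by simp [smul_comm a (op b) x]))

theorem lact_tmul [Module A X] [Module Aᵐᵒᵖ X] [SMulCommClass A Aᵐᵒᵖ X] [Module A Y]
    (a : A) (x : X) (y : Y) : lact A a (tmul A x y) = tmul A (a • x) y := rfl

/-- For an `(A, A)`-bimodule `Y`, right multiplication by `b` on `X ⊗_A Y`. -/
noncomputable def ract [Module Aᵐᵒᵖ X] [Module A Y] [Module Aᵐᵒᵖ Y] [SMulCommClass A Aᵐᵒᵖ Y]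
    (b : Aᵐᵒᵖ) : BalTensor A X Y →+ BalTensor A X Y :=
  QuotientAddGroup.map (balancedRel A X Y) (balancedRel A X Y)
    (TensorProduct.map LinearMap.id
      (DistribSMul.toAddMonoidHom Y b).toIntLinearMap).toAddMonoidHom (by
      refine (AddSubgroup.closure_le _).2 ?_
      rintro _ ⟨x, a, y, rfl⟩
      refine AddSubgroup.subset_closure ⟨x, a, b • y, ?_⟩
      exact (map_sub _ _ _).trans (by simp [smul_comm a b y]))

theorem ract_tmul [Module Aᵐᵒᵖ X] [Module A Y] [Module Aᵐᵒᵖ Y] [SMulCommClass A Aᵐᵒᵖ Y]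
    (b : Aᵐᵒᵖ) (x : X) (y : Y) : ract A b (tmul A x y) = tmul A x (b • y) := rfl

theorem add_tmul [Module Aᵐᵒᵖ X] [Module A Y] (x x' : X) (y : Y) :
    tmul A (x + x') y = tmul A x y + tmul A x' y :=
  congrArg (QuotientAddGroup.mk' (balancedRel A X Y)) (TensorProduct.add_tmul x x' y)

theorem tmul_add [Module Aᵐᵒᵖ X] [Module A Y] (x : X) (y y' : Y) :
    tmul A x (y + y') = tmul A x y + tmul A x y' :=
  congrArg (QuotientAddGroup.mk' (balancedRel A X Y)) (TensorProduct.tmul_add x y y')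

theorem zero_tmul [Module Aᵐᵒᵖ X] [Module A Y] (y : Y) : tmul A (0 : X) y = 0 :=
  congrArg (QuotientAddGroup.mk' (balancedRel A X Y)) (TensorProduct.zero_tmul X y)

theorem tmul_zero [Module Aᵐᵒᵖ X] [Module A Y] (x : X) : tmul A x (0 : Y) = 0 :=
  congrArg (QuotientAddGroup.mk' (balancedRel A X Y)) (TensorProduct.tmul_zero Y x)

/-- If `X` is an `(A, A)`-bimodule, then `X ⊗_A Y` is a left `A`-module: `a (x ⊗ y) = (a x) ⊗ y`. -/
noncomputable instance leftModule [Module A X] [Module Aᵐᵒᵖ X] [SMulCommClass A Aᵐᵒᵖ X]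
    [Module A Y] : Module A (BalTensor A X Y) where
  smul a t := lact A a t
  one_smul t := DFunLike.congr_fun (f := lact A 1) (g := AddMonoidHom.id _)
    (hom_ext A fun x y => by simp [lact_tmul]) t
  mul_smul a b t := DFunLike.congr_fun (f := lact A (a * b)) (g := (lact A a).comp (lact A b))
    (hom_ext A fun x y => by simp [lact_tmul, mul_smul]) t
  smul_zero a := map_zero (lact A a)
  smul_add a := map_add (lact A a)
  add_smul a b t := DFunLike.congr_fun (f := lact A (a + b)) (g := lact A a + lact A b)
    (hom_ext A fun x y => by simp [lact_tmul, add_smul, add_tmul]) t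
  zero_smul t := DFunLike.congr_fun (f := lact A 0) (g := 0)
    (hom_ext A fun x y => by simp [lact_tmul, zero_tmul]) t

/-- If `Y` is an `(A, A)`-bimodule, then `X ⊗_A Y` is a right `A`-module:
`(x ⊗ y) b = x ⊗ (y b)`. -/
noncomputable instance rightModule [Module Aᵐᵒᵖ X] [Module A Y] [Module Aᵐᵒᵖ Y]
    [SMulCommClass A Aᵐᵒᵖ Y] : Module Aᵐᵒᵖ (BalTensor A X Y) where
  smul b t := ract A b t
  one_smul t := DFunLike.congr_fun (f := ract A 1) (g := AddMonoidHom.id _)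
    (hom_ext A fun x y => by simp [ract_tmul]) t
  mul_smul a b t := DFunLike.congr_fun (f := ract A (a * b)) (g := (ract A a).comp (ract A b))
    (hom_ext A fun x y => by simp [ract_tmul, mul_smul]) t
  smul_zero b := map_zero (ract A b)
  smul_add b := map_add (ract A b)
  add_smul a b t := DFunLike.congr_fun (f := ract A (a + b)) (g := ract A a + ract A b)
    (hom_ext A fun x y => by simp [ract_tmul, add_smul, tmul_add]) t
  zero_smul t := DFunLike.congr_fun (f := ract A 0) (g := 0)
    (hom_ext A fun x y => by simp [ract_tmul, tmul_zero]) t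

end BalTensor

end Balanced

section Graded

variable {K A : Type*} [Field K] [Ring A] [Algebra K A] (𝒜 : ℕ → Submodule K A)

/-- A graded `K`-algebra `A = ⨁ i, 𝒜 i` is connected if `𝒜 0` has basis `1`, that is, every
element of `𝒜 0` is a unique scalar multiple of `1`. -/
class IsConnectedGraded : Prop where
  existsUnique_smul_one : ∀ a ∈ 𝒜 0, ∃! k : K, k • (1 : A) = a

variable [GradedAlgebra 𝒜] [IsConnectedGraded 𝒜]

/-- The value of the standard augmentation at `a`: the scalar `k` with `k • 1` equal to the
component of degree zero of `a`. -/
noncomputable def augmentationFun (a : A) : K :=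
  (IsConnectedGraded.existsUnique_smul_one (𝒜 := 𝒜) (DirectSum.decompose 𝒜 a 0 : A)
    (SetLike.coe_mem _)).choose

theorem augmentationFun_smul_one (a : A) :
    augmentationFun 𝒜 a • (1 : A) = (DirectSum.decompose 𝒜 a 0 : A) :=
  (IsConnectedGraded.existsUnique_smul_one (𝒜 := 𝒜) (DirectSum.decompose 𝒜 a 0 : A)
    (SetLike.coe_mem _)).choose_spec.1

theorem augmentationFun_eq {a : A} {k : K}
    (h : k • (1 : A) = (DirectSum.decompose 𝒜 a 0 : A)) : augmentationFun 𝒜 a = k :=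
  ((IsConnectedGraded.existsUnique_smul_one (𝒜 := 𝒜) (DirectSum.decompose 𝒜 a 0 : A)
    (SetLike.coe_mem _)).choose_spec.2 k h).symm

/-- The standard augmentation `A → K` of a connected graded algebra: it sends `1` to `1` and
`𝒜 i` to `0` for `i > 0`. -/
noncomputable def augmentation : A →ₐ[K] K where
  toFun := augmentationFun 𝒜
  map_one' := augmentationFun_eq 𝒜 (by
    rw [one_smul, DirectSum.decompose_of_mem_same 𝒜 SetLike.GradedOne.one_mem])
  map_mul' a b := augmentationFun_eq 𝒜 (by
    have h : (DirectSum.decompose 𝒜 (a * b) 0 : A) =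
        (DirectSum.decompose 𝒜 a 0 : A) * (DirectSum.decompose 𝒜 b 0 : A) :=
      map_mul (GradedRing.projZeroRingHom 𝒜) a b
    rw [h, ← augmentationFun_smul_one 𝒜 a, ← augmentationFun_smul_one 𝒜 b,
      smul_mul_smul_comm, one_mul])
  map_zero' := augmentationFun_eq 𝒜 (by simp)
  map_add' a b := augmentationFun_eq 𝒜 (by
    rw [add_smul, augmentationFun_smul_one, augmentationFun_smul_one, DirectSum.decompose_add]
    rfl)
  commutes' k := augmentationFun_eq 𝒜 (by
    rw [Algebra.algebraMap_eq_smul_one (A := A), DirectSum.decompose_of_mem_same 𝒜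
      (Submodule.smul_mem _ _ SetLike.GradedOne.one_mem)]
    simp)

theorem augmentation_of_mem {a : A} {i : ℕ} (hi : 0 < i) (ha : a ∈ 𝒜 i) :
    augmentation 𝒜 a = 0 :=
  augmentationFun_eq 𝒜 (by rw [zero_smul, DirectSum.decompose_of_mem_ne 𝒜 ha hi.ne'])

/-- The ground field `K`, as a left and as a right `A`-module through the augmentation. -/
def AugModule {K A : Type*} [Field K] [Ring A] [Algebra K A] (_ : ℕ → Submodule K A) : Type _ := K

noncomputable instance {K A : Type*} [Field K] [Ring A] [Algebra K A] (𝒜 : ℕ → Submodule K A) :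
    AddCommGroup (AugModule 𝒜) := inferInstanceAs (AddCommGroup K)

/-- The left action `a k = ε(a) k`. -/
noncomputable instance AugModule.leftModule : Module A (AugModule 𝒜) :=
  Module.compHom K (augmentation 𝒜 : A →+* K)

/-- The right action `k a = k ε(a)`. -/
noncomputable instance AugModule.rightModule : Module Aᵐᵒᵖ (AugModule 𝒜) :=
  Module.compHom K ((augmentation 𝒜 : A →+* K).fromOpposite fun _ _ => mul_comm _ _)

end Graded

section GradedBimodules

variable {K A : Type*} [Field K] [Ring A] [Algebra K A] (𝒜 : ℕ → Submodule K A)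

/-- The subspaces `ℳ i` of the `(A, A)`-bimodule `M` satisfy `𝒜 i ℳ j ⊆ ℳ (i + j)` and
`ℳ j 𝒜 i ⊆ ℳ (j + i)`. -/
class IsGradedBimodule {M : Type*} [AddCommGroup M] [Module K M] [Module A M] [Module Aᵐᵒᵖ M]
    (ℳ : ℕ → Submodule K M) : Prop where
  smul_mem : ∀ {i j : ℕ} {a : A} {m : M}, a ∈ 𝒜 i → m ∈ ℳ j → a • m ∈ ℳ (i + j)
  op_smul_mem : ∀ {i j : ℕ} {b : A} {m : M}, b ∈ 𝒜 i → m ∈ ℳ j → op b • m ∈ ℳ (j + i)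

/-- The homogeneous part of degree `k` of the graded free bimodule `(A ⊗[K] A) ^ r` whose `j`-th
basis element is placed in degree `δ j`: the `j`-th coordinate is a sum of elements `u ⊗ v` with
`u ∈ 𝒜 p`, `v ∈ 𝒜 q` and `p + q + δ j = k`. -/
noncomputable def freeBimoduleGrading {r : ℕ} (δ : Fin r → ℕ) (k : ℕ) :
    Submodule K (Fin r → OuterTensor K A) :=
  Submodule.pi Set.univ fun j => Submodule.span K
    {t | ∃ (p q : ℕ) (u v : A), u ∈ 𝒜 p ∧ v ∈ 𝒜 q ∧ p + q + δ j = k ∧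
      t = OuterTensor.tmul K A u v}

/-- A graded `(A, A)`-bimodule `M` is of type `FP_n` in the graded sense if there is a partial
resolution of `M` as in `IsBiFP` in which the finitely generated free bimodules are graded (with
homogeneous bases) and all maps are homogeneous of degree zero. -/
def IsGradedBiFP {M : Type*} [AddCommGroup M] [Module K M] [Module A M] [Module Aᵐᵒᵖ M]
    (ℳ : ℕ → Submodule K M) (n : ℕ) : Prop :=
  ∃ (r : ℕ → ℕ) (δ : ∀ i : ℕ, Fin (r i) → ℕ) (e : (Fin (r 0) → OuterTensor K A) →+ M)
    (d : ∀ i : ℕ, (Fin (r (i + 1)) → OuterTensor K A) →+ (Fin (r i) → OuterTensor K A)),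
    IsBimoduleHom A e ∧ (∀ i : ℕ, IsBimoduleHom A (d i)) ∧
    (∀ k : ℕ, ∀ x ∈ freeBimoduleGrading 𝒜 (δ 0) k, e x ∈ ℳ k) ∧
    (∀ i k : ℕ, ∀ x ∈ freeBimoduleGrading 𝒜 (δ (i + 1)) k,
      d i x ∈ freeBimoduleGrading 𝒜 (δ i) k) ∧
    Function.Surjective e ∧
    (0 < n → Function.Exact (d 0) e) ∧
    ∀ i : ℕ, i + 1 < n → Function.Exact (d (i + 1)) (d i)

end GradedBimodules

/-! A bimodule is a left module over the enveloping algebra `E`, here `OuterTensor K A` with the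
product of `A ⊗ Aᵐᵒᵖ`, and finitely generated free bimodules are the modules `E ^ r`. In case (i),
`M ⊗_A K` is `M / M A₊`. Finitely many homogeneous elements of `M` generate this quotient over `A`,
and since degrees are bounded below, graded Nakayama shows that they generate `M` as a bimodule.
This gives a graded cover `E ^ r → M` with kernel `N`.

As `M` is projective on the right, the cover splits over `Aᵐᵒᵖ`. Hence `0 → N → E ^ r → M → 0` stays
exact after `- ⊗_A K`, and `N / N A₊` is the kernel of a surjection `A ^ r → M / M A₊`. By
Schanuel's lemma that kernel is of type `FP_{n-1}`. Moreover `N` is graded and, as a right direct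
summand of `E ^ r`, again projective on the right, so the argument repeats. Freeness is weakened to
projectivity because only projectivity is seen to pass to the kernel.

Case (ii) is the mirror image. Both come from one argument about a ring `E` with commuting actions
of rings `L` and `R` and a map `q : E → L` that kills the positive part of `R` (`IsAugmented`); `(L,
R)` is `(A, Aᵐᵒᵖ)` in (i) and `(Aᵐᵒᵖ, A)` in (ii). The main steps are `IsFP.ker_of_surjective`,
`surjective_of_sub_mem_augSub`, `IsAugmented.nonempty_equiv_ker` and `IsAugmented.exists_cover`. -/

/-! ### Modules of type `FP_n` and Schanuel's lemma. -/

section FiniteType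

variable {R : Type*} [Ring R]

/-- A surjection onto a projective module splits off its target. -/
theorem LinearMap.nonempty_equiv_ker_prod {Z G : Type*} [AddCommGroup Z] [Module R Z]
    [AddCommGroup G] [Module R G] [Module.Projective R G] (g : Z →ₗ[R] G)
    (hg : Function.Surjective g) : Nonempty (Z ≃ₗ[R] LinearMap.ker g × G) := by
  obtain ⟨s, hs⟩ := g.exists_rightInverse_of_surjective (LinearMap.range_eq_top.2 hg)
  have hs' : ∀ y, g (s y) = y := fun y => LinearMap.congr_fun hs y
  refine ⟨(LinearEquiv.ofBijective ((LinearMap.ker g).subtype.coprod s) ⟨?_, ?_⟩).symm⟩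
  · rw [injective_iff_map_eq_zero]
    rintro ⟨⟨x, hx⟩, y⟩ h
    have h' : x + s y = 0 := by simpa using h
    have hy : y = 0 := by
      have := congrArg g h'
      simpa [hs', LinearMap.mem_ker.1 hx] using this
    subst hy
    simp at h'
    simp [h']
  · intro z
    exact ⟨(⟨z - s (g z), by simp [hs']⟩, g z), by simp⟩

/-- A module embedded onto the kernel of a linear map is isomorphic to that kernel. -/
theorem Function.Exact.nonempty_equiv_ker {X Y Z : Type*} [AddCommGroup X] [AddCommGroup Y]
    [AddCommGroup Z] [Module R X] [Module R Y] [Module R Z] {j : X →ₗ[R] Y} {e : Y →ₗ[R] Z}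
    (h : Function.Exact j e) (hj : Function.Injective j) :
    Nonempty (X ≃ₗ[R] LinearMap.ker e) :=
  ⟨(LinearEquiv.ofInjective j hj).trans
    (LinearEquiv.ofEq _ _ (LinearMap.exact_iff.1 h).symm)⟩

namespace IsFP

variable {M N : Type*} [AddCommGroup M] [Module R M] [AddCommGroup N] [Module R N]

theorem of_equiv {n : ℕ} (h : IsFP R M n) (f : M ≃ₗ[R] N) : IsFP R N n := by
  obtain ⟨r, e, d, he, h0, h1⟩ := h
  refine ⟨r, f.toLinearMap ∘ₗ e, d, f.surjective.comp he, fun hn x => ?_, h1⟩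
  rw [← h0 hn x]
  simp

theorem zero_iff : IsFP R M 0 ↔
    ∃ (r : ℕ) (e : (Fin r → R) →ₗ[R] M), Function.Surjective e := by
  constructor
  · rintro ⟨r, e, d, he, -⟩
    exact ⟨r 0, e, he⟩
  · rintro ⟨r, e, he⟩
    exact ⟨fun _ => r, e, fun _ => 0, he, fun h => absurd h (lt_irrefl _),
      fun i h => absurd h (Nat.not_lt_zero _)⟩

/-- Peeling off the first cover reduces later arguments to one cover and its kernel. In the converse
the cover takes index `0` and the resolution of the kernel is shifted up by one. -/
theorem succ_iff {n : ℕ} : IsFP R M (n + 1) ↔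
    ∃ (r : ℕ) (e : (Fin r → R) →ₗ[R] M), Function.Surjective e ∧
      IsFP R (LinearMap.ker e) n := by
  constructor
  · rintro ⟨r, e, d, he, h0, h1⟩
    have h0 := h0 n.succ_pos
    refine ⟨r 0, e, he, fun i => r (i + 1),
      (d 0).codRestrict (LinearMap.ker e) fun x => h0.apply_apply_eq_zero x,
      fun i => d (i + 1), ?_, fun hn x => ?_, fun i hi => h1 (i + 1) (by omega)⟩
    · rintro ⟨y, hy⟩
      obtain ⟨x, rfl⟩ := (h0 y).1 hy
      exact ⟨x, rfl⟩
    · rw [← h1 0 (by omega) x, ← Submodule.coe_eq_zero]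
      rfl
  · rintro ⟨r₀, e, he, r, e', d, he', h0, h1⟩
    refine ⟨fun i => Nat.casesOn i r₀ r, e, fun i => Nat.casesOn (motive := fun i =>
      (Fin (Nat.casesOn (i + 1) r₀ r : ℕ) → R) →ₗ[R] (Fin (Nat.casesOn i r₀ r : ℕ) → R)) i
      ((LinearMap.ker e).subtype ∘ₗ e') d, he, fun _ x => ?_, fun i hi => ?_⟩
    · constructor
      · intro hx
        obtain ⟨y, hy⟩ := he' ⟨x, hx⟩
        exact ⟨y, congrArg Subtype.val hy⟩
      · rintro ⟨y, rfl⟩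
        exact (e' y).2
    · cases i with
      | zero =>
        intro x
        rw [← h0 (by omega) x, ← Submodule.coe_eq_zero]
        rfl
      | succ i => exact h1 i (by omega)

/-- Extending a cover by the identity of `R ^ s` leaves its kernel unchanged up to isomorphism, so
no induction is needed. -/
theorem prod_free {n : ℕ} (h : IsFP R M n) (s : ℕ) : IsFP R (M × (Fin s → R)) n := by
  have key : ∀ {r : ℕ} (e : (Fin r → R) →ₗ[R] M), Function.Surjective e →
      ∃ e' : (Fin (r + s) → R) →ₗ[R] M × (Fin s → R), Function.Surjective e' ∧
        Nonempty (LinearMap.ker e ≃ₗ[R] LinearMap.ker e') := by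
    intro r e he
    let φ : (Fin (r + s) → R) ≃ₗ[R] (Fin r → R) × (Fin s → R) :=
      (LinearEquiv.funCongrLeft R R finSumFinEquiv).trans
        (LinearEquiv.sumArrowLequivProdArrow (Fin r) (Fin s) R R)
    refine ⟨(e.prodMap LinearMap.id) ∘ₗ φ.toLinearMap,
      (Function.Surjective.prodMap he Function.surjective_id).comp φ.surjective, ?_⟩
    refine Function.Exact.nonempty_equiv_ker
      (j := φ.symm.toLinearMap ∘ₗ LinearMap.inl R _ _ ∘ₗ (LinearMap.ker e).subtype) ?_ ?_
    · intro x
      obtain ⟨⟨y, z⟩, rfl⟩ := φ.symm.surjective x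
      constructor
      · intro hx
        have hx' : e y = 0 ∧ z = 0 := by simpa using hx
        exact ⟨⟨y, hx'.1⟩, by simp [hx'.2]⟩
      · rintro ⟨⟨w, hw⟩, h⟩
        have h' : (w, (0 : Fin s → R)) = (y, z) := by simpa using h
        obtain ⟨rfl, rfl⟩ := Prod.mk.inj h'
        simpa using hw
    · exact φ.symm.injective.comp (LinearMap.inl_injective.comp Subtype.val_injective)
  cases n with
  | zero =>
    obtain ⟨r, e, he⟩ := zero_iff.1 h
    obtain ⟨e', he', -⟩ := key e he
    exact zero_iff.2 ⟨_, e', he'⟩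
  | succ n =>
    obtain ⟨r, e, he, hk⟩ := succ_iff.1 h
    obtain ⟨e', he', ⟨f⟩⟩ := key e he
    exact succ_iff.2 ⟨_, e', he', hk.of_equiv f⟩

theorem of_ker_free {n s : ℕ} (g : M →ₗ[R] (Fin s → R)) (hg : Function.Surjective g)
    (h : IsFP R (LinearMap.ker g) n) : IsFP R M n := by
  obtain ⟨f⟩ := g.nonempty_equiv_ker_prod hg
  exact (h.prod_free s).of_equiv f.symm

/-- A cover of `M × R ^ s` followed by the first projection covers `M`; its kernel is an extension
of `R ^ s` by the old kernel, which `of_ker_free` handles. -/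
theorem fst_of_prod_free {n s : ℕ} (h : IsFP R (M × (Fin s → R)) n) : IsFP R M n := by
  cases n with
  | zero =>
    obtain ⟨r, e, he⟩ := zero_iff.1 h
    exact zero_iff.2 ⟨r, LinearMap.fst R M (Fin s → R) ∘ₗ e, Prod.fst_surjective.comp he⟩
  | succ n =>
    obtain ⟨r, e, he, hk⟩ := succ_iff.1 h
    refine succ_iff.2 ⟨r, LinearMap.fst R M (Fin s → R) ∘ₗ e, Prod.fst_surjective.comp he, ?_⟩
    let g : LinearMap.ker (LinearMap.fst R M (Fin s → R) ∘ₗ e) →ₗ[R] (Fin s → R) :=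
      LinearMap.snd R _ _ ∘ₗ e ∘ₗ Submodule.subtype _
    have hg : Function.Surjective g := by
      intro y
      obtain ⟨x, hx⟩ := he (0, y)
      exact ⟨⟨x, by simp [hx]⟩, by simp [g, hx]⟩
    have hle : LinearMap.ker e ≤ LinearMap.ker (LinearMap.fst R M (Fin s → R) ∘ₗ e) :=
      fun x hx => by simp [LinearMap.mem_ker.1 hx]
    obtain ⟨f⟩ := Function.Exact.nonempty_equiv_ker (j := Submodule.inclusion hle) (e := g)
      (fun x => by
        constructor
        · intro hx
          exact ⟨⟨x, LinearMap.mem_ker.2 (Prod.ext x.2 hx)⟩, rfl⟩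
        · rintro ⟨y, rfl⟩
          exact congrArg Prod.snd (LinearMap.mem_ker.1 y.2)) (Submodule.inclusion_injective hle)
    exact of_ker_free g hg (hk.of_equiv f)

/-- A form of Schanuel's lemma: the kernel of a surjection from a finitely generated free module
onto a module of type `FP_{n + 1}` is of type `FP_n`. -/
theorem ker_of_surjective {n a : ℕ} (h : IsFP R M (n + 1)) (f : (Fin a → R) →ₗ[R] M)
    (hf : Function.Surjective f) : IsFP R (LinearMap.ker f) n := by
  obtain ⟨b, g, hg, hk⟩ := succ_iff.1 h
  -- The fibre product of the two covers. It maps onto both free modules, with kernels isomorphic to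
  -- `ker g` (along `p`) and `ker f` (along `q`).
  let X := LinearMap.ker (f.coprod (-g))
  have hX : ∀ x : (Fin a → R) × (Fin b → R), x ∈ X ↔ f x.1 = g x.2 := fun x => by
    simp [X, LinearMap.mem_ker, ← sub_eq_add_neg, sub_eq_zero]
  let p : X →ₗ[R] (Fin a → R) := LinearMap.fst R _ _ ∘ₗ X.subtype
  let q : X →ₗ[R] (Fin b → R) := LinearMap.snd R _ _ ∘ₗ X.subtype
  have hp : Function.Surjective p := fun y => by
    obtain ⟨z, hz⟩ := hg (f y)
    exact ⟨⟨(y, z), (hX _).2 hz.symm⟩, rfl⟩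
  have hq : Function.Surjective q := fun z => by
    obtain ⟨y, hy⟩ := hf (g z)
    exact ⟨⟨(y, z), (hX _).2 hy⟩, rfl⟩
  obtain ⟨φ⟩ := Function.Exact.nonempty_equiv_ker (e := p)
    (j := (LinearMap.inr R (Fin a → R) (Fin b → R) ∘ₗ (LinearMap.ker g).subtype).codRestrict X
      fun x => (hX _).2 (by simp))
    (fun x => by
      constructor
      · intro hx
        have hx : x.1.1 = 0 := hx
        refine ⟨⟨x.1.2, ?_⟩, Subtype.ext (Prod.ext hx.symm rfl)⟩
        rw [LinearMap.mem_ker, ← (hX _).1 x.2, hx, map_zero]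
      · rintro ⟨y, rfl⟩
        rfl)
    (fun x y h => Subtype.ext (congrArg (fun z : X => z.1.2) h))
  obtain ⟨ψ⟩ := Function.Exact.nonempty_equiv_ker (e := q)
    (j := (LinearMap.inl R (Fin a → R) (Fin b → R) ∘ₗ (LinearMap.ker f).subtype).codRestrict X
      fun x => (hX _).2 (by simp))
    (fun x => by
      constructor
      · intro hx
        have hx : x.1.2 = 0 := hx
        refine ⟨⟨x.1.1, ?_⟩, Subtype.ext (Prod.ext rfl hx.symm)⟩
        rw [LinearMap.mem_ker, (hX _).1 x.2, hx, map_zero]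
      · rintro ⟨y, rfl⟩
        rfl)
    (fun x y h => Subtype.ext (congrArg (fun z : X => z.1.1) h))
  obtain ⟨χ⟩ := q.nonempty_equiv_ker_prod hq
  have hXn : IsFP R X n := of_ker_free p hp (hk.of_equiv φ)
  have hqn : IsFP R (LinearMap.ker q) n := fst_of_prod_free (hXn.of_equiv χ)
  exact hqn.of_equiv ψ.symm

end IsFP

end FiniteType

/-! ### Gradings described by their projections. -/

section GradingProjections

variable {K M N : Type*} [Field K] [AddCommGroup M] [Module K M] [AddCommGroup N] [Module K N]

/-- The additive maps `P k` are the projections onto the parts `ℳ k` of a direct sum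
decomposition `M = ⨁ k, ℳ k`. -/
structure IsGradingProj (ℳ : ℕ → Submodule K M) (P : ℕ → M →+ M) : Prop where
  same : ∀ {k : ℕ} {x : M}, x ∈ ℳ k → P k x = x
  ne : ∀ {k l : ℕ} {x : M}, x ∈ ℳ l → k ≠ l → P k x = 0
  iSup_eq_top : ⨆ k, ℳ k = ⊤

namespace IsGradingProj

variable {ℳ : ℕ → Submodule K M} {P : ℕ → M →+ M} {𝒩 : ℕ → Submodule K N} {Q : ℕ → N →+ N}

@[elab_as_elim]
theorem induction (h : IsGradingProj ℳ P) {p : M → Prop} (x : M)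
    (mem : ∀ k, ∀ y ∈ ℳ k, p y) (add : ∀ y z, p y → p z → p (y + z)) : p x :=
  Submodule.iSup_induction ℳ (motive := p) (h.iSup_eq_top ▸ Submodule.mem_top : x ∈ ⨆ k, ℳ k) mem
    (mem 0 0 (zero_mem _)) add

theorem mem (h : IsGradingProj ℳ P) (k : ℕ) (x : M) : P k x ∈ ℳ k := by
  refine h.induction x (fun l y hy => ?_) fun y z hy hz => by
    rw [map_add]; exact add_mem hy hz
  by_cases hkl : k = l
  · subst hkl; rwa [h.same hy]
  · rw [h.ne hy hkl]; exact zero_mem _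

/-- Asking for all `N' ≥ N` makes the claim additive in `x`: take the larger of two bounds. -/
theorem exists_sum (h : IsGradingProj ℳ P) (x : M) :
    ∃ N, ∀ N' ≥ N, ∑ i ∈ Finset.range N', P i x = x := by
  refine h.induction x (fun l y hy => ⟨l + 1, fun N' hN => ?_⟩) ?_
  · rw [Finset.sum_eq_single l (fun i _ hi => h.ne hy hi)
      (fun hl => absurd (Finset.mem_range.2 hN) hl), h.same hy]
  · rintro y z ⟨n₁, h₁⟩ ⟨n₂, h₂⟩
    refine ⟨max n₁ n₂, fun N' hN => ?_⟩
    simp only [map_add, Finset.sum_add_distrib]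
    rw [h₁ N' (le_trans (le_max_left _ _) hN), h₂ N' (le_trans (le_max_right _ _) hN)]

theorem map_comm (h : IsGradingProj ℳ P) (h' : IsGradingProj 𝒩 Q) (f : M →+ N)
    (hf : ∀ k, ∀ x ∈ ℳ k, f x ∈ 𝒩 k) (k : ℕ) (x : M) : f (P k x) = Q k (f x) := by
  refine h.induction x (fun l y hy => ?_) fun y z hy hz => by
    simp only [map_add, hy, hz]
  by_cases hkl : k = l
  · subst hkl; rw [h.same hy, h'.same (hf _ _ hy)]
  · rw [h.ne hy hkl, h'.ne (hf _ _ hy) hkl, map_zero]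

end IsGradingProj

end GradingProjections

/-! ### Graded free modules and graded partial resolutions. -/

section GradedModules

variable {K E : Type*} [Field K] [Ring E] [Module K E]

/-- The grading of the free module `E ^ r` whose `j`-th basis element is placed in degree `δ j`. -/
def shiftedGrading (ℰ : ℕ → Submodule K E) {r : ℕ} (δ : Fin r → ℕ) (k : ℕ) :
    Submodule K (Fin r → E) :=
  Submodule.pi Set.univ fun j => if δ j ≤ k then ℰ (k - δ j) else ⊥

theorem mem_shiftedGrading {ℰ : ℕ → Submodule K E} {r : ℕ} {δ : Fin r → ℕ} {k : ℕ}
    {x : Fin r → E} : x ∈ shiftedGrading ℰ δ k ↔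
      ∀ j, x j ∈ (if δ j ≤ k then ℰ (k - δ j) else ⊥) := by
  simp [shiftedGrading, Submodule.mem_pi]

/-- The projections of `shiftedGrading`. -/
noncomputable def shiftedProj (P : ℕ → E →+ E) {r : ℕ} (δ : Fin r → ℕ) (k : ℕ) :
    (Fin r → E) →+ (Fin r → E) where
  toFun x j := if δ j ≤ k then P (k - δ j) (x j) else 0
  map_zero' := by ext j; simp
  map_add' x y := by
    ext j
    by_cases h : δ j ≤ k <;> simp [h]

theorem IsGradingProj.shifted {ℰ : ℕ → Submodule K E} {P : ℕ → E →+ E} (h : IsGradingProj ℰ P)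
    {r : ℕ} (δ : Fin r → ℕ) : IsGradingProj (shiftedGrading ℰ δ) (shiftedProj P δ) where
  same {k x} hx := by
    ext j
    have := mem_shiftedGrading.1 hx j
    by_cases hk : δ j ≤ k
    · rw [if_pos hk] at this
      simp [shiftedProj, hk, h.same this]
    · rw [if_neg hk, Submodule.mem_bot] at this
      simp [shiftedProj, hk, this]
  ne {k l x} hx hkl := by
    ext j
    have := mem_shiftedGrading.1 hx j
    by_cases hl : δ j ≤ l
    · rw [if_pos hl] at this
      by_cases hk : δ j ≤ k
      -- Neither subtraction is truncated here, so distinct degrees stay distinct after the shift.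
      · simp [shiftedProj, hk, h.ne this (show k - δ j ≠ l - δ j by omega)]
      · simp [shiftedProj, hk]
    · rw [if_neg hl, Submodule.mem_bot] at this
      simp [shiftedProj, this]
  iSup_eq_top := by
    rw [eq_top_iff]
    intro x _
    rw [← Finset.univ_sum_single x]
    refine sum_mem fun j _ => ?_
    refine h.induction (x j) (fun k y hy => ?_) fun y z hy hz => by
      rw [Pi.single_add]; exact add_mem hy hz
    refine Submodule.mem_iSup_of_mem (k + δ j) (mem_shiftedGrading.2 fun i => ?_)
    by_cases hij : i = j
    · subst hij; simpa using hy
    · simp [Pi.single_eq_of_ne hij]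

variable {M : Type*} [AddCommGroup M] [Module K M] [Module E M]

/-- The grading induced on a submodule. -/
def submoduleGrading [IsScalarTower K E M] (ℳ : ℕ → Submodule K M) (N : Submodule E M) (k : ℕ) : Submodule K N :=
  (ℳ k).comap (N.subtype.restrictScalars K)

/-- A submodule that is stable under the projections of a grading is graded. -/
theorem IsGradingProj.submodule [IsScalarTower K E M] {ℳ : ℕ → Submodule K M} {P : ℕ → M →+ M}
    (h : IsGradingProj ℳ P) (N : Submodule E M) (hN : ∀ k, ∀ x ∈ N, P k x ∈ N) :
    IsGradingProj (submoduleGrading ℳ N) fun k =>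
      ((P k).comp N.subtype.toAddMonoidHom).codRestrict N fun x => hN k x x.2 where
  same hx := Subtype.ext (h.same hx)
  ne hx hkl := Subtype.ext (h.ne hx hkl)
  iSup_eq_top := by
    rw [eq_top_iff]
    intro x _
    obtain ⟨n, hn⟩ := h.exists_sum (x : M)
    have hx : x = ∑ i ∈ Finset.range n, (⟨P i x, hN i x x.2⟩ : N) :=
      Subtype.ext (by simpa using (hn n le_rfl).symm)
    rw [hx]
    exact sum_mem fun i _ => Submodule.mem_iSup_of_mem i (h.mem i _)

/-- A graded module `M` over a graded ring `E` has a partial resolution of length `n` by finitely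
generated free graded modules with homogeneous bases, the maps being homogeneous of degree `0`. -/
def IsGradedFP (ℰ : ℕ → Submodule K E) (ℳ : ℕ → Submodule K M) (n : ℕ) : Prop :=
  ∃ (r : ℕ → ℕ) (δ : ∀ i : ℕ, Fin (r i) → ℕ) (e : (Fin (r 0) → E) →ₗ[E] M)
    (d : ∀ i : ℕ, (Fin (r (i + 1)) → E) →ₗ[E] (Fin (r i) → E)),
    (∀ k : ℕ, ∀ x ∈ shiftedGrading ℰ (δ 0) k, e x ∈ ℳ k) ∧
    (∀ i k : ℕ, ∀ x ∈ shiftedGrading ℰ (δ (i + 1)) k, d i x ∈ shiftedGrading ℰ (δ i) k) ∧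
    Function.Surjective e ∧
    (0 < n → Function.Exact (d 0) e) ∧
    ∀ i : ℕ, i + 1 < n → Function.Exact (d (i + 1)) (d i)

theorem IsGradedFP.zero {ℰ : ℕ → Submodule K E} {ℳ : ℕ → Submodule K M} {r : ℕ}
    (δ : Fin r → ℕ) (e : (Fin r → E) →ₗ[E] M)
    (he : ∀ k, ∀ x ∈ shiftedGrading ℰ δ k, e x ∈ ℳ k) (hs : Function.Surjective e) :
    IsGradedFP ℰ ℳ 0 :=
  ⟨fun _ => r, fun _ => δ, e, fun _ => 0, he, fun _ _ _ _ => zero_mem _, hs,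
    fun h => absurd h (lt_irrefl _), fun _ h => absurd h (Nat.not_lt_zero _)⟩

theorem IsGradedFP.succ [IsScalarTower K E E] {ℰ : ℕ → Submodule K E} {ℳ : ℕ → Submodule K M}
    {r₀ n : ℕ} (δ₀ : Fin r₀ → ℕ) (e : (Fin r₀ → E) →ₗ[E] M)
    (he : ∀ k, ∀ x ∈ shiftedGrading ℰ δ₀ k, e x ∈ ℳ k) (hs : Function.Surjective e)
    (h : IsGradedFP ℰ (submoduleGrading (shiftedGrading ℰ δ₀) (LinearMap.ker e)) n) :
    IsGradedFP ℰ ℳ (n + 1) := by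
  obtain ⟨r, δ, e', d, hg, hgd, he', h0, h1⟩ := h
  refine ⟨fun i => Nat.casesOn i r₀ r, fun i => Nat.casesOn (motive := fun i =>
    Fin (Nat.casesOn i r₀ r : ℕ) → ℕ) i δ₀ δ, e, fun i => Nat.casesOn (motive := fun i =>
    (Fin (Nat.casesOn (i + 1) r₀ r : ℕ) → E) →ₗ[E] (Fin (Nat.casesOn i r₀ r : ℕ) → E)) i
    ((LinearMap.ker e).subtype ∘ₗ e') d, he, fun i k x hx => ?_, hs, fun _ x => ?_,
    fun i hi => ?_⟩
  · cases i with
    | zero => exact hg k x hx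
    | succ i => exact hgd i k x hx
  · constructor
    · intro hx
      obtain ⟨y, hy⟩ := he' ⟨x, hx⟩
      exact ⟨y, congrArg Subtype.val hy⟩
    · rintro ⟨y, rfl⟩
      exact (e' y).2
  · cases i with
    | zero =>
      intro x
      rw [← h0 (by omega) x, ← Submodule.coe_eq_zero]
      rfl
    | succ i => exact h1 i (by omega)

end GradedModules

/-! ### The submodule `M R₊` and graded Nakayama. -/

section AugmentationSubmodule

variable (L : Type*) {R : Type*} [Ring L] [Ring R] (S : ℕ → Set R)

/-- The submodule generated by the elements `b • m` with `b` homogeneous of positive degree, where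
`S p` is the set of homogeneous elements of degree `p` of `R`. -/
def augSub (M : Type*) [AddCommGroup M] [Module L M] [Module R M] [SMulCommClass L R M] :
    Submodule L M :=
  { AddSubgroup.closure {x : M | ∃ p, 0 < p ∧ ∃ b ∈ S p, ∃ m : M, x = b • m} with
    smul_mem' := fun a x hx => by
      induction hx using AddSubgroup.closure_induction with
      | mem x hx =>
        obtain ⟨p, hp, b, hb, m, rfl⟩ := hx
        exact AddSubgroup.subset_closure ⟨p, hp, b, hb, a • m, smul_comm a b m⟩
      | zero => rw [smul_zero]; exact zero_mem (AddSubgroup.closure _)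
      | add x y _ _ hx hy => rw [smul_add]; exact add_mem (S := AddSubgroup M) hx hy
      | neg x _ hx => rw [smul_neg]; exact neg_mem (S := AddSubgroup M) hx }

variable {L S} {M N : Type*} [AddCommGroup M] [Module L M] [Module R M] [SMulCommClass L R M]
  [AddCommGroup N] [Module L N] [Module R N] [SMulCommClass L R N]

theorem smul_mem_augSub {p : ℕ} (hp : 0 < p) {b : R} (hb : b ∈ S p) (m : M) :
    b • m ∈ augSub L S M :=
  AddSubgroup.subset_closure ⟨p, hp, b, hb, m, rfl⟩

theorem augSub_induction {P : M → Prop}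
    (smul : ∀ p, 0 < p → ∀ b ∈ S p, ∀ m : M, P (b • m)) (zero : P 0)
    (add : ∀ x y, P x → P y → P (x + y)) (neg : ∀ x, P x → P (-x)) {x : M}
    (hx : x ∈ augSub L S M) : P x := by
  refine AddSubgroup.closure_induction (p := fun x _ => P x) ?_ zero
    (fun x y _ _ => add x y) (fun x _ => neg x) hx
  rintro _ ⟨p, hp, b, hb, m, rfl⟩
  exact smul p hp b hb m

/-- Only compatibility with `R` is required: the retraction onto a kernel, to which this is applied,
is not known to be `L`-linear. -/
theorem map_mem_augSub (f : M →+ N) (hf : ∀ (b : R) (x : M), f (b • x) = b • f x) {x : M}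
    (hx : x ∈ augSub L S M) : f x ∈ augSub L S N :=
  augSub_induction (P := fun x => f x ∈ augSub L S N)
    (fun p hp b hb m => by rw [hf]; exact smul_mem_augSub hp hb _)
    (by rw [map_zero]; exact zero_mem _)
    (fun x y hx hy => by rw [map_add]; exact add_mem hx hy)
    (fun x hx => by rw [map_neg]; exact neg_mem hx) hx

/-- Lifting along a surjection carries `augSub` back to `augSub`. -/
theorem exists_mem_augSub (f : M →+ N) (hf : ∀ (b : R) (x : M), f (b • x) = b • f x)
    (hs : Function.Surjective f) {y : N} (hy : y ∈ augSub L S N) :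
    ∃ x ∈ augSub L S M, f x = y :=
  augSub_induction (P := fun y => ∃ x ∈ augSub L S M, f x = y)
    (fun p hp b hb m => by
      obtain ⟨x, rfl⟩ := hs m
      exact ⟨b • x, smul_mem_augSub hp hb _, hf b x⟩)
    ⟨0, zero_mem _, map_zero f⟩
    (by
      rintro _ _ ⟨x, hx, rfl⟩ ⟨y, hy, rfl⟩
      exact ⟨x + y, add_mem hx hy, map_add f x y⟩)
    (by
      rintro _ ⟨x, hx, rfl⟩
      exact ⟨-x, neg_mem hx, map_neg f x⟩) hy

/-- Kernels of `E`-linear covers inherit the commuting actions, so that `augSub` makes sense for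
them. -/
instance Submodule.smulCommClass_of_tower {E : Type*} [Ring E] [Module E M] [SMul L E] [SMul R E]
    [IsScalarTower L E M] [IsScalarTower R E M] (X : Submodule E M) : SMulCommClass L R X :=
  ⟨fun a b x => Subtype.ext (smul_comm a b (x : M))⟩

/-- A graded Nakayama lemma. -/
theorem surjective_of_sub_mem_augSub {K F : Type*} [Field K] [Module K M] [AddCommGroup F]
    [Module K F] [Module R F] {ℳ : ℕ → Submodule K M} {P : ℕ → M →+ M} {ℱ : ℕ → Submodule K F}
    {Q : ℕ → F →+ F} (hP : IsGradingProj ℳ P) (hQ : IsGradingProj ℱ Q)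
    (hS : ∀ {p i : ℕ} {b : R} {m : M}, b ∈ S p → m ∈ ℳ i → b • m ∈ ℳ (p + i))
    (e : F →+ M) (heR : ∀ (b : R) (x : F), e (b • x) = b • e x)
    (he : ∀ k, ∀ x ∈ ℱ k, e x ∈ ℳ k) (h : ∀ x, ∃ y, x - e y ∈ augSub L S M) :
    Function.Surjective e := by
  have key : ∀ k, ∀ x ∈ ℳ k, x ∈ e.range := by
    intro k
    induction k using Nat.strong_induction_on with
    | _ k ih =>
      -- The part of degree `k` of `b • m`, with `b` of degree `p > 0`, is `b` times a part of `m`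
      -- of degree less than `k`, which lies in the range by induction.
      have aux : ∀ z ∈ augSub L S M, P k z ∈ e.range := fun z hz => by
        refine augSub_induction (P := fun z => P k z ∈ e.range) (fun p hp b hb m => ?_)
          (by rw [map_zero]; exact zero_mem _)
          (fun x y hx hy => by rw [map_add]; exact add_mem hx hy)
          (fun x hx => by rw [map_neg]; exact neg_mem hx) hz
        refine hP.induction m (fun i y hy => ?_) fun y z hy hz => by
          rw [smul_add, map_add]; exact add_mem hy hz
        by_cases hk : k = p + i
        · rw [hk, hP.same (hS hb hy)]
          obtain ⟨w, rfl⟩ := ih i (by omega) y hy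
          exact ⟨b • w, heR b w⟩
        · rw [hP.ne (hS hb hy) hk]
          exact zero_mem _
      intro x hx
      obtain ⟨y, hy⟩ := h x
      have h1 := aux _ hy
      -- Taking parts of degree `k` turns `x - e y` into `x - e (Q k y)`.
      rw [map_sub, hP.same hx, ← hQ.map_comm hP e he] at h1
      have h2 := add_mem h1 (⟨Q k y, rfl⟩ : e (Q k y) ∈ e.range)
      rwa [sub_add_cancel] at h2
  exact fun x => hP.induction (p := fun x => x ∈ e.range) x key fun y z hy hz => add_mem hy hz

/-- Finitely many homogeneous elements generate a finitely generated quotient of a graded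
module. -/
theorem exists_homogeneous_span_eq_top {K : Type*} [Field K] [Module K M] {ℳ : ℕ → Submodule K M}
    {P : ℕ → M →+ M} (hP : IsGradingProj ℳ P) (X : Submodule L M) [Module.Finite L (M ⧸ X)] :
    ∃ (r : ℕ) (δ : Fin r → ℕ) (m : Fin r → M), (∀ j, m j ∈ ℳ (δ j)) ∧
      Submodule.span L (Set.range fun j => X.mkQ (m j)) = ⊤ := by
  let T : Set M := {x | ∃ k, x ∈ ℳ k}
  have hT : Submodule.span L (X.mkQ '' T) = ⊤ := by
    have : Submodule.span L T = ⊤ := eq_top_iff.2 fun x _ =>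
      hP.induction (p := fun x => x ∈ Submodule.span L T) x
        (fun k y hy => Submodule.subset_span ⟨k, hy⟩) fun y z hy hz => add_mem hy hz
    rw [Submodule.span_image, this, Submodule.map_top, Submodule.range_mkQ]
  have hfg : (Submodule.span L (X.mkQ '' T)).FG := hT ▸ Module.Finite.fg_top
  -- A finitely generated span is already spanned by finitely many members of the given set, so the
  -- generators can be kept homogeneous.
  obtain ⟨s, hs, hspan⟩ := (Submodule.fg_span_iff_fg_span_finset_subset _).1 hfg
  have hch : ∀ j : Fin s.card, ∃ m : M, (∃ k, m ∈ ℳ k) ∧ X.mkQ m = s.equivFin.symm j :=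
    fun j => hs (s.equivFin.symm j).2
  choose m hm hmq using hch
  choose δ hδ using hm
  refine ⟨s.card, δ, m, hδ, ?_⟩
  have : (Set.range fun j => X.mkQ (m j)) = s := by
    ext y
    constructor
    · rintro ⟨j, rfl⟩
      simp only [hmq]
      exact (s.equivFin.symm j).2
    · intro hy
      exact ⟨s.equivFin ⟨y, hy⟩, by simp [hmq]⟩
  rw [this, ← hspan, hT]

end AugmentationSubmodule

/-! ### One step of the resolution over `E`. -/

section Resolution

variable {K E L R : Type*} [Field K] [Ring E] [Module K E] [Ring L] [Ring R]
  [Module L E] [Module R E] [SMulCommClass L R E]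

/-- `E` behaves like the tensor product of `L` with a connected graded algebra `R` whose homogeneous
parts are `S p`: the map `q` is induced by the augmentation of `R`. -/
structure IsAugmented (ℰ : ℕ → Submodule K E) (S : ℕ → Set R) (q : E →ₗ[L] L) : Prop where
  smul_one_mem : ∀ {p : ℕ} {b : R}, b ∈ S p → b • (1 : E) ∈ ℰ p
  q_one : q 1 = 1
  q_smul : ∀ {p : ℕ} {b : R}, 0 < p → b ∈ S p → ∀ t : E, q (b • t) = 0
  sub_mem : ∀ t : E, t - q t • (1 : E) ∈ augSub L S E

variable {ℰ : ℕ → Submodule K E} {S : ℕ → Set R} {q : E →ₗ[L] L}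

theorem IsAugmented.map_augSub (h : IsAugmented ℰ S q) (r : ℕ) {x : Fin r → E}
    (hx : x ∈ augSub L S (Fin r → E)) : q.compLeft (Fin r) x = 0 :=
  augSub_induction (P := fun x => q.compLeft (Fin r) x = 0)
    (fun p hp b hb m => funext fun j => h.q_smul hp hb (m j)) (map_zero _)
    (fun x y hx hy => by rw [map_add, hx, hy, add_zero])
    (fun x hx => by rw [map_neg, hx, neg_zero]) hx

/-- With `map_augSub`, this identifies the kernel of `q ^ r`. Coordinatewise, `sub_mem` gives the
claim when `q (x j) = 0`, and inclusions of coordinates are `R`-linear. -/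
theorem IsAugmented.mem_augSub (h : IsAugmented ℰ S q) (r : ℕ) {x : Fin r → E}
    (hx : q.compLeft (Fin r) x = 0) : x ∈ augSub L S (Fin r → E) := by
  rw [← Finset.univ_sum_single x]
  refine sum_mem fun j _ => ?_
  refine map_mem_augSub (LinearMap.single R (fun _ : Fin r => E) j).toAddMonoidHom
    (LinearMap.single R (fun _ : Fin r => E) j).map_smul ?_
  have h1 : q (x j) = 0 := congrFun hx j
  have h2 := h.sub_mem (x j)
  rwa [h1, zero_smul, sub_zero] at h2

variable {M : Type*} [AddCommGroup M] [Module E M] [Module L M] [Module R M] [SMulCommClass L R M] [IsScalarTower L E M] [IsScalarTower R E M]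

/-- The action of `E` on `M / M R₊` factors through `q`, since `t - q t • 1` is in `augSub` of `E`
and so moves `m` into `augSub` of `M`. -/
theorem IsAugmented.mkQ_smul (h : IsAugmented ℰ S q) (t : E) (m : M) :
    (augSub L S M).mkQ (t • m) = q t • (augSub L S M).mkQ m := by
  rw [← map_smul, ← sub_eq_zero, ← map_sub, Submodule.mkQ_apply, Submodule.Quotient.mk_eq_zero]
  have := map_mem_augSub (L := L) (S := S) (AddMonoidHom.flip (smulAddHom E M) m)
    (fun b x => smul_assoc b x m) (h.sub_mem t)
  simpa [sub_smul, smul_assoc] using this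

variable {r : ℕ} (m : Fin r → M)

theorem IsAugmented.linearCombination_mkQ (h : IsAugmented ℰ S q) (x : Fin r → E) :
    Fintype.linearCombination L (fun j => (augSub L S M).mkQ (m j)) (q.compLeft (Fin r) x) =
      (augSub L S M).mkQ (Fintype.linearCombination E m x) := by
  simp only [Fintype.linearCombination_apply, map_sum, h.mkQ_smul]
  rfl

theorem smul_one_smul_linearCombination (c : Fin r → L) :
    Fintype.linearCombination E m (fun j => c j • (1 : E)) = ∑ j, c j • m j := by
  simp [Fintype.linearCombination_apply, smul_assoc]

/-- A surjection onto an `R`-projective module has a retraction onto its kernel. -/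
theorem exists_retraction {F : Type*} [AddCommGroup F] [Module E F] [Module R F]
    [IsScalarTower R E F] [Module.Projective R M] (e : F →ₗ[E] M) (he : Function.Surjective e) :
    ∃ ρ : F →ₗ[R] LinearMap.ker e, ∀ x : LinearMap.ker e, ρ x = x := by
  let e' : F →ₗ[R] M := e.restrictScalars R
  obtain ⟨s, hs⟩ := e'.exists_rightInverse_of_surjective (LinearMap.range_eq_top.2 he)
  have hs' : ∀ y, e (s y) = y := fun y => LinearMap.congr_fun hs y
  refine ⟨
    { toFun := fun x => ⟨x - s (e x), by simp [hs']⟩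
      map_add' := fun x y => ?_
      map_smul' := fun b x => ?_ }, fun x => ?_⟩
  · ext; simp; abel
  · have : e (b • x) = b • e x := e'.map_smul b x
    ext; simp [this, smul_sub]
  · ext; simp

variable [IsScalarTower L E E] [IsScalarTower R E E]

/-- The kernel of the free cover of `M` given by `m`, modulo the augmentation, is the kernel of the
corresponding cover of `M` modulo the augmentation. -/
theorem IsAugmented.nonempty_equiv_ker (h : IsAugmented ℰ S q) [Module.Projective R M]
    (hm : Function.Surjective (Fintype.linearCombination E m)) :
    Nonempty ((LinearMap.ker (Fintype.linearCombination E m) ⧸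
        augSub L S (LinearMap.ker (Fintype.linearCombination E m))) ≃ₗ[L]
      LinearMap.ker (Fintype.linearCombination L fun j => (augSub L S M).mkQ (m j))) := by
  set e := Fintype.linearCombination E m with he
  set f := Fintype.linearCombination L fun j => (augSub L S M).mkQ (m j) with hf
  have hfe : ∀ x, f (q.compLeft (Fin r) x) = (augSub L S M).mkQ (e x) := h.linearCombination_mkQ m
  obtain ⟨ρ, hρ⟩ := exists_retraction (R := R) e hm
  let ι : LinearMap.ker e →ₗ[L] (Fin r → E) := (LinearMap.ker e).subtype.restrictScalars L
  let g : LinearMap.ker e →ₗ[L] LinearMap.ker f :=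
    (q.compLeft (Fin r) ∘ₗ ι).codRestrict _ fun x => by
      have hx : e (x : Fin r → E) = 0 := x.2
      rw [LinearMap.mem_ker, LinearMap.comp_apply, hfe]
      exact (congrArg _ hx).trans (map_zero _)
  have hker : augSub L S (LinearMap.ker e) = LinearMap.ker g := by
    ext x
    rw [LinearMap.mem_ker]
    constructor
    · intro hx
      exact Subtype.ext (h.map_augSub r
        (map_mem_augSub (LinearMap.ker e).subtype.toAddMonoidHom (fun _ _ => rfl) hx))
    · intro hx
      -- Projectivity is used here: as `ρ` is `R`-linear and fixes the kernel, an element of the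
      -- kernel lying in `E ^ r R₊` lies in the augmentation submodule of the kernel itself.
      rw [← hρ x]
      exact map_mem_augSub ρ.toAddMonoidHom (fun b y => ρ.map_smul b y)
        (h.mem_augSub r (congrArg Subtype.val hx))
  have hg : Function.Surjective g := by
    rintro ⟨c, hc⟩
    -- The obvious lift of `c` need not lie in the kernel, but `e x` is in `M R₊`. Subtracting a
    -- preimage of `e x` in `E ^ r R₊` corrects this without changing the image under `q`.
    let x : Fin r → E := fun j => c j • (1 : E)
    have hx : q.compLeft (Fin r) x = c := by
      ext j
      simp [x, h.q_one]
    have hex : e x ∈ augSub L S M := by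
      rw [← Submodule.Quotient.mk_eq_zero, ← Submodule.mkQ_apply, ← hfe, hx]
      exact hc
    obtain ⟨y, hy, hyx⟩ := exists_mem_augSub e.toAddMonoidHom
      (fun b x => (e.restrictScalars R).map_smul b x) hm hex
    have hyx : e y = e x := hyx
    refine ⟨⟨x - y, by simp [hyx]⟩, Subtype.ext ?_⟩
    change q.compLeft (Fin r) (x - y) = c
    rw [map_sub, hx, h.map_augSub r hy, sub_zero]
  exact ⟨(Submodule.quotEquivOfEq _ _ hker).trans (g.quotKerEquivOfSurjective hg)⟩

theorem linearCombination_mem_of_shifted [Module K M] {ℳ : ℕ → Submodule K M}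
    (hℳ : ∀ {i j : ℕ} {t : E} {x : M}, t ∈ ℰ i → x ∈ ℳ j → t • x ∈ ℳ (i + j))
    {δ : Fin r → ℕ} (hm : ∀ j, m j ∈ ℳ (δ j)) (k : ℕ) :
    ∀ x ∈ shiftedGrading ℰ δ k, Fintype.linearCombination E m x ∈ ℳ k := by
  intro x hx
  rw [Fintype.linearCombination_apply]
  refine sum_mem fun j _ => ?_
  have h := mem_shiftedGrading.1 hx j
  by_cases hk : δ j ≤ k
  · rw [if_pos hk] at h
    simpa [Nat.sub_add_cancel hk] using hℳ h (hm j)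
  · rw [if_neg hk, Submodule.mem_bot] at h
    rw [h, zero_smul]
    exact zero_mem _

theorem smul_mem_shiftedGrading
    (hmul : ∀ {i j : ℕ} {s t : E}, s ∈ ℰ i → t ∈ ℰ j → s * t ∈ ℰ (i + j))
    (δ : Fin r → ℕ) {i k : ℕ} {t : E} {x : Fin r → E} (ht : t ∈ ℰ i)
    (hx : x ∈ shiftedGrading ℰ δ k) : t • x ∈ shiftedGrading ℰ δ (i + k) := by
  refine mem_shiftedGrading.2 fun j => ?_
  have h := mem_shiftedGrading.1 hx j
  by_cases hk : δ j ≤ k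
  · rw [if_pos hk] at h
    rw [if_pos (by omega), Nat.add_sub_assoc hk]
    exact hmul ht h
  · rw [if_neg hk, Submodule.mem_bot] at h
    rw [Pi.smul_apply, h, smul_zero]
    exact zero_mem _

/-- If `M / M R₊` is of type `FP_n`, then `M` is covered by a finitely generated graded free module
whose kernel satisfies the same hypotheses for `n - 1`. -/
theorem IsAugmented.exists_cover [IsScalarTower K E E] (h : IsAugmented ℰ S q) {P : ℕ → E →+ E}
    (hP : IsGradingProj ℰ P)
    [Module.Projective R E] [Module K M] {ℳ : ℕ → Submodule K M} {Q : ℕ → M →+ M}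
    (hQ : IsGradingProj ℳ Q)
    (hℳ : ∀ {i j : ℕ} {t : E} {x : M}, t ∈ ℰ i → x ∈ ℳ j → t • x ∈ ℳ (i + j))
    [Module.Projective R M] {n : ℕ} (hM : IsFP L (M ⧸ augSub L S M) n) :
    ∃ (r : ℕ) (δ : Fin r → ℕ) (e : (Fin r → E) →ₗ[E] M),
      (∀ k, ∀ x ∈ shiftedGrading ℰ δ k, e x ∈ ℳ k) ∧ Function.Surjective e ∧
      Module.Projective R (LinearMap.ker e) ∧
      (∃ Q', IsGradingProj (submoduleGrading (shiftedGrading ℰ δ) (LinearMap.ker e)) Q') ∧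
      ∀ l, n = l + 1 → IsFP L (LinearMap.ker e ⧸ augSub L S (LinearMap.ker e)) l := by
  have : Module.Finite L (M ⧸ augSub L S M) := by
    obtain ⟨r, e, d, he, -⟩ := hM
    exact Module.Finite.of_surjective e he
  obtain ⟨r, δ, m, hm, hspan⟩ := exists_homogeneous_span_eq_top hQ (augSub L S M)
  have hgr := linearCombination_mem_of_shifted m hℳ hm
  have hfs : Function.Surjective (Fintype.linearCombination L fun j => (augSub L S M).mkQ (m j)) := by
    rw [← LinearMap.range_eq_top, Fintype.range_linearCombination, hspan]
  -- Nakayama: modulo `M R₊`, each `x` is a combination of the `m j` over `L`, which lifts to `E ^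
  -- r` through `c j • 1`.
  have hes : Function.Surjective (Fintype.linearCombination E m) := by
    refine surjective_of_sub_mem_augSub (L := L) (S := S) hQ (hP.shifted δ) (fun hb hx => ?_)
      (Fintype.linearCombination E m).toAddMonoidHom
      (fun b x => ((Fintype.linearCombination E m).restrictScalars R).map_smul b x) hgr fun x => ?_
    · have := hℳ (h.smul_one_mem hb) hx
      rwa [smul_assoc, one_smul] at this
    · obtain ⟨c, hc⟩ := hfs ((augSub L S M).mkQ x)
      refine ⟨fun j => c j • (1 : E), ?_⟩
      rw [← Submodule.Quotient.mk_eq_zero, ← Submodule.mkQ_apply, map_sub, ← hc, sub_eq_zero]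
      refine Eq.trans ?_ (congrArg (augSub L S M).mkQ (smul_one_smul_linearCombination m c).symm)
      simp [Fintype.linearCombination_apply]
  refine ⟨r, δ, Fintype.linearCombination E m, hgr, hes, ?_, ⟨_, (hP.shifted δ).submodule _ ?_⟩, ?_⟩
  -- The kernel is a direct summand of `E ^ r` over `R`.
  · obtain ⟨ρ, hρ⟩ := exists_retraction (R := R) (Fintype.linearCombination E m) hes
    have : Module.Projective R (Fin r → E) :=
      Module.Projective.of_equiv (DFinsupp.linearEquivFunOnFintype (R := R) (M := fun _ : Fin r => E))
    exact Module.Projective.of_split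
      ((LinearMap.ker (Fintype.linearCombination E m)).subtype.restrictScalars R) ρ
      (LinearMap.ext hρ)
  -- The cover commutes with the projections, so its kernel is stable under them.
  · intro k x hx
    have := (hP.shifted δ).map_comm hQ (Fintype.linearCombination E m).toAddMonoidHom hgr k x
    rw [LinearMap.mem_ker] at hx ⊢
    exact this.trans ((congrArg (Q k) hx).trans (map_zero _))
  · rintro l rfl
    obtain ⟨φ⟩ := h.nonempty_equiv_ker m hes
    exact (hM.ker_of_surjective _ hfs).of_equiv φ.symm

end Resolution

/-! ### Iterating the step. -/

section Induction

universe u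

variable {K L R : Type*} {E : Type u} [Field K] [Ring E] [Module K E] [Ring L] [Ring R]
  [Module L E] [Module R E] [SMulCommClass L R E] [IsScalarTower K E E] [IsScalarTower L E E]
  [IsScalarTower R E E] {ℰ : ℕ → Submodule K E} {S : ℕ → Set R} {q : E →ₗ[L] L}

/-- Stated for submodules of `E ^ r`, which the kernels are: these stay in the universe of `E`, as
the induction requires, whereas `M` may live in another one. -/
theorem IsAugmented.isGradedFP_submodule (h : IsAugmented ℰ S q) {P : ℕ → E →+ E}
    (hP : IsGradingProj ℰ P)
    (hmul : ∀ {i j : ℕ} {s t : E}, s ∈ ℰ i → t ∈ ℰ j → s * t ∈ ℰ (i + j))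
    [Module.Projective R E] (n : ℕ) : ∀ {r : ℕ} (δ : Fin r → ℕ) (X : Submodule E (Fin r → E))
    {Q : ℕ → X →+ X}, IsGradingProj (submoduleGrading (shiftedGrading ℰ δ) X) Q →
    Module.Projective R X → IsFP L (X ⧸ augSub L S X) n →
    IsGradedFP ℰ (submoduleGrading (shiftedGrading ℰ δ) X) n := by
  induction n with
  | zero =>
    intro r δ X Q hQ hX hFP
    obtain ⟨r', δ', e, hg, hs, -, -, -⟩ := h.exists_cover hP hQ
      (fun ht hx => smul_mem_shiftedGrading hmul δ ht hx) hFP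
    exact .zero δ' e hg hs
  | succ n ih =>
    intro r δ X Q hQ hX hFP
    obtain ⟨r', δ', e, hg, hs, hproj, ⟨Q', hQ'⟩, hker⟩ := h.exists_cover hP hQ
      (fun ht hx => smul_mem_shiftedGrading hmul δ ht hx) hFP
    exact .succ δ' e hg hs (ih δ' _ hQ' hproj (hker n rfl))

/-- A graded module `M` that is projective over `R` and of type `FP_n` over `L` modulo the
augmentation of `R` is of type `FP_n` over `E` in the graded sense. -/
theorem IsAugmented.isGradedFP (h : IsAugmented ℰ S q) {P : ℕ → E →+ E}
    (hP : IsGradingProj ℰ P)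
    (hmul : ∀ {i j : ℕ} {s t : E}, s ∈ ℰ i → t ∈ ℰ j → s * t ∈ ℰ (i + j))
    [Module.Projective R E] {M : Type*} [AddCommGroup M] [Module E M] [Module L M] [Module R M]
    [SMulCommClass L R M] [IsScalarTower L E M] [IsScalarTower R E M] [Module K M]
    {ℳ : ℕ → Submodule K M} {Q : ℕ → M →+ M} (hQ : IsGradingProj ℳ Q)
    (hℳ : ∀ {i j : ℕ} {t : E} {x : M}, t ∈ ℰ i → x ∈ ℳ j → t • x ∈ ℳ (i + j))
    [Module.Projective R M] {n : ℕ} (hM : IsFP L (M ⧸ augSub L S M) n) :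
    IsGradedFP ℰ ℳ n := by
  obtain ⟨r, δ, e, hg, hs, hproj, ⟨Q', hQ'⟩, hker⟩ := h.exists_cover hP hQ hℳ hM
  cases n with
  | zero => exact .zero δ e hg hs
  | succ n =>
    exact .succ δ e hg hs (h.isGradedFP_submodule hP hmul n δ _ hQ' hproj (hker n rfl))

end Induction

/-! ### The enveloping algebra and its modules. -/

namespace OuterTensor

variable (K A : Type*) [Field K] [Ring A] [Algebra K A]

/-- The free bimodule of rank one is the enveloping algebra. -/
noncomputable def toEnveloping : OuterTensor K A ≃ₗ[K] A ⊗[K] Aᵐᵒᵖ :=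
  TensorProduct.congr (LinearEquiv.refl K A) (opLinearEquiv K)

theorem toEnveloping_tmul (u v : A) : toEnveloping K A (tmul K A u v) = u ⊗ₜ[K] op v := rfl

/-- The product is pulled back to the free bimodule itself, so that a resolution by modules `E ^ r`
needs no transport to become one by free bimodules. -/
noncomputable instance : Mul (OuterTensor K A) :=
  ⟨fun x y => (toEnveloping K A).symm (toEnveloping K A x * toEnveloping K A y)⟩

noncomputable instance : One (OuterTensor K A) := ⟨tmul K A 1 1⟩

variable {K A}

theorem toEnveloping_mul (x y : OuterTensor K A) :
    toEnveloping K A (x * y) = toEnveloping K A x * toEnveloping K A y :=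
  (toEnveloping K A).apply_symm_apply _

theorem toEnveloping_one : toEnveloping K A 1 = 1 := rfl

theorem one_eq_tmul : (1 : OuterTensor K A) = tmul K A 1 1 := rfl

theorem tmul_mul_tmul (u v u' v' : A) :
    tmul K A u v * tmul K A u' v' = tmul K A (u * u') (v' * v) :=
  (toEnveloping K A).injective (by
    rw [toEnveloping_mul]
    simp only [toEnveloping_tmul, Algebra.TensorProduct.tmul_mul_tmul, op_mul])

noncomputable instance : Ring (OuterTensor K A) :=
  { (inferInstance : AddCommGroup (OuterTensor K A)),
    (inferInstance : Mul (OuterTensor K A)), (inferInstance : One (OuterTensor K A)) with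
    left_distrib := fun x y z => (toEnveloping K A).injective (by
      simp only [toEnveloping_mul, map_add, mul_add])
    right_distrib := fun x y z => (toEnveloping K A).injective (by
      simp only [toEnveloping_mul, map_add, add_mul])
    zero_mul := fun x => (toEnveloping K A).injective (by
      simp only [toEnveloping_mul, map_zero, zero_mul])
    mul_zero := fun x => (toEnveloping K A).injective (by
      simp only [toEnveloping_mul, map_zero, mul_zero])
    mul_assoc := fun x y z => (toEnveloping K A).injective (by
      simp only [toEnveloping_mul, mul_assoc])
    one_mul := fun x => (toEnveloping K A).injective (by
      simp only [toEnveloping_mul, toEnveloping_one, one_mul])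
    mul_one := fun x => (toEnveloping K A).injective (by
      simp only [toEnveloping_mul, toEnveloping_one, mul_one]) }

instance : IsScalarTower K (OuterTensor K A) (OuterTensor K A) :=
  ⟨fun k x y => (toEnveloping K A).injective (by
    simp only [smul_eq_mul, toEnveloping_mul, map_smul, smul_mul_assoc])⟩

instance : SMulCommClass Aᵐᵒᵖ A (OuterTensor K A) := SMulCommClass.symm _ _ _

/-- A bimodule is a left module over the enveloping algebra. -/
@[reducible]
noncomputable def bimoduleModule (K : Type*) {A : Type*} (M : Type*) [Field K] [Ring A]
    [Algebra K A] [AddCommGroup M] [Module K M] [Module A M] [Module Aᵐᵒᵖ M]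
    [SMulCommClass A Aᵐᵒᵖ M] [IsScalarTower K A M] [IsScalarTower K Aᵐᵒᵖ M] :
    Module (OuterTensor K A) M :=
  letI : Module (A ⊗[K] Aᵐᵒᵖ) M := TensorProduct.Algebra.module
  Module.compHom M
    { toFun := toEnveloping K A
      map_one' := toEnveloping_one
      map_mul' := toEnveloping_mul
      map_zero' := map_zero _
      map_add' := map_add _ : OuterTensor K A →+* A ⊗[K] Aᵐᵒᵖ }

theorem bimoduleModule_smul {M : Type*} [AddCommGroup M] [Module K M] [Module A M]
    [Module Aᵐᵒᵖ M] [SMulCommClass A Aᵐᵒᵖ M] [IsScalarTower K A M] [IsScalarTower K Aᵐᵒᵖ M]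
    (u v : A) (m : M) :
    letI := bimoduleModule K (A := A) M
    tmul K A u v • m = u • op v • m := rfl

/-- The action of `E` is known only through its formula on pure tensors, so that both `M` and `E`
itself are covered. -/
theorem isScalarTower_left {M : Type*} [AddCommGroup M] [Module A M] [Module Aᵐᵒᵖ M]
    [Module (OuterTensor K A) M] (h : ∀ (u v : A) (m : M), tmul K A u v • m = u • op v • m) :
    IsScalarTower A (OuterTensor K A) M :=
  ⟨fun a t m => by
    refine OuterTensor.induction K A (P := fun t => (a • t) • m = a • t • m) ?_ ?_ ?_ t
    · simp
    · intro u v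
      rw [OuterTensor.smul_tmul, h, h, mul_smul]
    · intro s t hs ht
      simp only [smul_add, add_smul, hs, ht]⟩

theorem isScalarTower_right {M : Type*} [AddCommGroup M] [Module A M] [Module Aᵐᵒᵖ M]
    [SMulCommClass A Aᵐᵒᵖ M] [Module (OuterTensor K A) M]
    (h : ∀ (u v : A) (m : M), tmul K A u v • m = u • op v • m) :
    IsScalarTower Aᵐᵒᵖ (OuterTensor K A) M :=
  ⟨fun b t m => by
    refine OuterTensor.induction K A (P := fun t => (b • t) • m = b • t • m) ?_ ?_ ?_ t
    · simp
    · intro u v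
      obtain ⟨b, rfl⟩ := op_surjective b
      rw [OuterTensor.op_smul_tmul, h, h, op_mul, mul_smul, smul_comm u (op b)]
    · intro s t hs ht
      simp only [smul_add, add_smul, hs, ht]⟩

theorem tmul_smul_self (u v : A) (t : OuterTensor K A) :
    tmul K A u v • t = u • op v • t := by
  refine OuterTensor.induction K A (P := fun t => tmul K A u v • t = u • op v • t) ?_ ?_ ?_ t
  · simp
  · intro u' v'
    rw [smul_eq_mul, tmul_mul_tmul, OuterTensor.op_smul_tmul, OuterTensor.smul_tmul]
  · intro s t hs ht
    simp only [smul_add, hs, ht]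

instance : IsScalarTower A (OuterTensor K A) (OuterTensor K A) :=
  isScalarTower_left tmul_smul_self

instance : IsScalarTower Aᵐᵒᵖ (OuterTensor K A) (OuterTensor K A) :=
  isScalarTower_right tmul_smul_self

instance projective_left : Module.Projective A (OuterTensor K A) := by
  have : Module.Free A (A ⊗[K] A) := inferInstance
  have e : (A ⊗[K] A) ≃ₗ[A] OuterTensor K A :=
    { AddEquiv.refl (A ⊗[K] A) with
      map_smul' := fun a t => by
        induction t with
        | zero => rfl
        | tmul u v => rfl
        | add s t hs ht =>
          exact (congrArg _ (smul_add a s t)).trans ((congrArg₂ (· + ·) hs ht).trans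
            (smul_add a (s : OuterTensor K A) (t : OuterTensor K A)).symm) }
  exact Module.Projective.of_equiv e

/-- Scalar extension of a `K`-vector space is free for the action on the left factor; exchanging the
factors brings the right action there. -/
instance projective_right : Module.Projective Aᵐᵒᵖ (OuterTensor K A) := by
  have : Module.Free Aᵐᵒᵖ (Aᵐᵒᵖ ⊗[K] A) := inferInstance
  let ψ : (Aᵐᵒᵖ ⊗[K] A) ≃ₗ[K] OuterTensor K A :=
    (TensorProduct.congr (opLinearEquiv K).symm (LinearEquiv.refl K A)).trans
      (TensorProduct.comm K A A)
  have e : (Aᵐᵒᵖ ⊗[K] A) ≃ₗ[Aᵐᵒᵖ] OuterTensor K A :=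
    { ψ.toAddEquiv with
      map_smul' := fun a t => by
        change ψ (a • t) = a • ψ t
        induction t with
        | zero => simp
        | tmul u v => rfl
        | add s t hs ht => simp only [smul_add, map_add, hs, ht] }
  exact Module.Projective.of_equiv e

end OuterTensor

/-! ### The grading of the enveloping algebra by total degree. -/

section OuterGrading

variable {K A : Type*} [Field K] [Ring A] [Algebra K A] (𝒜 : ℕ → Submodule K A)

/-- The grading of the enveloping algebra. -/
noncomputable def outerGrading (k : ℕ) : Submodule K (OuterTensor K A) :=
  Submodule.span K {t | ∃ (p q : ℕ) (u v : A), u ∈ 𝒜 p ∧ v ∈ 𝒜 q ∧ p + q = k ∧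
    t = OuterTensor.tmul K A u v}

variable {𝒜}

theorem tmul_mem_outerGrading {p q : ℕ} {u v : A} (hu : u ∈ 𝒜 p) (hv : v ∈ 𝒜 q) :
    OuterTensor.tmul K A u v ∈ outerGrading 𝒜 (p + q) :=
  Submodule.subset_span ⟨p, q, u, v, hu, hv, rfl, rfl⟩

theorem freeBimoduleGrading_eq {r : ℕ} (δ : Fin r → ℕ) (k : ℕ) :
    freeBimoduleGrading 𝒜 δ k = shiftedGrading (outerGrading 𝒜) δ k := by
  unfold freeBimoduleGrading shiftedGrading outerGrading
  congr 1
  ext1 j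
  by_cases hk : δ j ≤ k
  · rw [if_pos hk]
    congr 1
    ext t
    have : ∀ p q, p + q + δ j = k ↔ p + q = k - δ j := fun p q => by omega
    simp only [Set.mem_ofPred_eq, this]
  -- Below degree `δ j` no `p` and `q` satisfy the equation, so the spanning set is empty.
  · rw [if_neg hk, Submodule.span_eq_bot]
    rintro t ⟨p, q, u, v, -, -, h, -⟩
    omega

theorem isGradingProj_decompose {M : Type*} [AddCommGroup M] [Module K M]
    (ℳ : ℕ → Submodule K M) [DirectSum.Decomposition ℳ] :
    IsGradingProj ℳ fun k =>
      { toFun := fun x => (DirectSum.decompose ℳ x k : M)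
        map_zero' := by simp
        map_add' := fun x y => by simp } where
  same hx := DirectSum.decompose_of_mem_same ℳ hx
  ne hx hkl := DirectSum.decompose_of_mem_ne ℳ hx hkl.symm
  iSup_eq_top := (DirectSum.Decomposition.isInternal ℳ).submodule_iSup_eq_top

/-- Besides `M`, this serves for `E` acting on itself, where it makes `E` a graded ring. -/
theorem smul_mem_of_outerGrading {M : Type*} [AddCommGroup M] [Module K M] [Module A M]
    [Module Aᵐᵒᵖ M] [Module (OuterTensor K A) M] [IsScalarTower K (OuterTensor K A) M]
    (h : ∀ (u v : A) (m : M), OuterTensor.tmul K A u v • m = u • op v • m)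
    {ℳ : ℕ → Submodule K M} [IsGradedBimodule 𝒜 ℳ] {i j : ℕ} {t : OuterTensor K A} {x : M}
    (ht : t ∈ outerGrading 𝒜 i) (hx : x ∈ ℳ j) : t • x ∈ ℳ (i + j) := by
  refine Submodule.span_induction (p := fun t _ => t • x ∈ ℳ (i + j)) ?_
    (by rw [zero_smul]; exact zero_mem _) (fun s t _ _ hs ht => by
      rw [add_smul]; exact add_mem hs ht) (fun c s _ hs => by
      rw [smul_assoc]; exact Submodule.smul_mem _ c hs) ht
  rintro _ ⟨p, q, u, v, hu, hv, rfl, rfl⟩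
  rw [h]
  have := IsGradedBimodule.smul_mem hu (IsGradedBimodule.op_smul_mem hv hx : _ ∈ ℳ (j + q))
  rwa [show p + q + j = p + (j + q) by omega]

variable (𝒜) [GradedAlgebra 𝒜]

/-- The projections of the enveloping algebra onto its homogeneous parts. -/
noncomputable def outerProj (k : ℕ) : OuterTensor K A →+ OuterTensor K A :=
  (∑ pq ∈ Finset.HasAntidiagonal.antidiagonal k,
    TensorProduct.map (GradedAlgebra.proj 𝒜 pq.1) (GradedAlgebra.proj 𝒜 pq.2) :
      A ⊗[K] A →ₗ[K] A ⊗[K] A).toAddMonoidHom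

variable {𝒜}

theorem outerProj_tmul (k : ℕ) {p q : ℕ} {u v : A} (hu : u ∈ 𝒜 p) (hv : v ∈ 𝒜 q) :
    outerProj 𝒜 k (OuterTensor.tmul K A u v) =
      if p + q = k then OuterTensor.tmul K A u v else 0 := by
  have h : outerProj 𝒜 k (OuterTensor.tmul K A u v) = ∑ pq ∈ Finset.HasAntidiagonal.antidiagonal k,
      OuterTensor.tmul K A (DirectSum.decompose 𝒜 u pq.1) (DirectSum.decompose 𝒜 v pq.2) := by
    change (∑ pq ∈ Finset.HasAntidiagonal.antidiagonal k, TensorProduct.map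
      (GradedAlgebra.proj 𝒜 pq.1) (GradedAlgebra.proj 𝒜 pq.2) :
        A ⊗[K] A →ₗ[K] A ⊗[K] A) (u ⊗ₜ[K] v) = _
    rw [LinearMap.sum_apply]
    rfl
  have hz : ∀ pq : ℕ × ℕ, pq ≠ (p, q) → OuterTensor.tmul K A (DirectSum.decompose 𝒜 u pq.1)
      (DirectSum.decompose 𝒜 v pq.2) = 0 := by
    intro pq hne
    by_cases h1 : p = pq.1
    · have h2 : q ≠ pq.2 := fun h2 => hne (Prod.ext h1.symm h2.symm)
      rw [DirectSum.decompose_of_mem_ne 𝒜 hv h2]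
      exact TensorProduct.tmul_zero _ _
    · rw [DirectSum.decompose_of_mem_ne 𝒜 hu h1]
      exact TensorProduct.zero_tmul _ _
  rw [h]
  split_ifs with hk
  · rw [Finset.sum_eq_single (p, q) (fun pq _ hne => hz pq hne)
      (fun hn => absurd (Finset.HasAntidiagonal.mem_antidiagonal.2 hk) hn),
      DirectSum.decompose_of_mem_same 𝒜 hu, DirectSum.decompose_of_mem_same 𝒜 hv]
  · refine Finset.sum_eq_zero fun pq hpq => hz pq ?_
    rintro rfl
    exact hk (Finset.HasAntidiagonal.mem_antidiagonal.1 hpq)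

theorem outerProj_of_mem {k l : ℕ} {x : OuterTensor K A} (hx : x ∈ outerGrading 𝒜 l) :
    outerProj 𝒜 k x = if l = k then x else 0 := by
  refine Submodule.span_induction (p := fun x _ => outerProj 𝒜 k x = if l = k then x else 0)
    ?_ (by simp) (fun x y _ _ hx hy => ?_) (fun c x _ hx => ?_) hx
  · rintro _ ⟨p, q, u, v, hu, hv, rfl, rfl⟩
    exact outerProj_tmul k hu hv
  · rw [map_add, hx, hy]
    split_ifs <;> simp
  · have : outerProj 𝒜 k (c • x) = c • outerProj 𝒜 k x :=
      LinearMap.map_smul (∑ pq ∈ Finset.HasAntidiagonal.antidiagonal k,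
        TensorProduct.map (GradedAlgebra.proj 𝒜 pq.1) (GradedAlgebra.proj 𝒜 pq.2)) c x
    rw [this, hx]
    split_ifs <;> simp

theorem isGradingProj_outer : IsGradingProj (outerGrading 𝒜) (outerProj 𝒜) where
  same hx := by rw [outerProj_of_mem hx, if_pos rfl]
  ne hx hkl := by rw [outerProj_of_mem hx, if_neg hkl.symm]
  iSup_eq_top := by
    rw [eq_top_iff]
    intro x _
    refine OuterTensor.induction K A (P := fun x => x ∈ ⨆ k, outerGrading 𝒜 k) (zero_mem _)
      (fun u v => ?_) (fun s t hs ht => add_mem hs ht) x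
    refine (isGradingProj_decompose 𝒜).induction u (fun p u hu => ?_) fun y z hy hz => ?_
    · refine (isGradingProj_decompose 𝒜).induction v (fun q v hv => ?_) fun y z hy hz => ?_
      · exact Submodule.mem_iSup_of_mem _ (tmul_mem_outerGrading hu hv)
      · have : OuterTensor.tmul K A u (y + z) = OuterTensor.tmul K A u y +
          OuterTensor.tmul K A u z := TensorProduct.tmul_add _ _ _
        rw [this]
        exact add_mem hy hz
    · have : OuterTensor.tmul K A (y + z) v = OuterTensor.tmul K A y v +
        OuterTensor.tmul K A z v := TensorProduct.add_tmul _ _ _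
      rw [this]
      exact add_mem hy hz

instance : IsGradedBimodule 𝒜 (outerGrading 𝒜) where
  smul_mem {i j a m} ha hm := by
    refine Submodule.span_induction (p := fun m _ => a • m ∈ outerGrading 𝒜 (i + j)) ?_
      (by rw [smul_zero]; exact zero_mem _) (fun s t _ _ hs ht => by
        rw [smul_add]; exact add_mem hs ht) (fun c s _ hs => ?_) hm
    · rintro _ ⟨p, q, u, v, hu, hv, rfl, rfl⟩
      rw [OuterTensor.smul_tmul, ← add_assoc]
      exact tmul_mem_outerGrading (SetLike.mul_mem_graded ha hu) hv
    · have : a • c • s = c • a • s := LinearMap.map_smul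
        (Module.End.rTensorAlgHom K A A (Algebra.lsmul K K A a) : A ⊗[K] A →ₗ[K] A ⊗[K] A) c s
      rw [this]
      exact Submodule.smul_mem _ c hs
  op_smul_mem {i j b m} hb hm := by
    refine Submodule.span_induction (p := fun m _ => op b • m ∈ outerGrading 𝒜 (j + i)) ?_
      (by rw [smul_zero]; exact zero_mem _) (fun s t _ _ hs ht => by
        rw [smul_add]; exact add_mem hs ht) (fun c s _ hs => ?_) hm
    · rintro _ ⟨p, q, u, v, hu, hv, rfl, rfl⟩
      rw [OuterTensor.op_smul_tmul, add_assoc]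
      exact tmul_mem_outerGrading hu (SetLike.mul_mem_graded hv hb)
    · have : op b • c • s = c • op b • s := LinearMap.map_smul
        (Module.End.lTensorAlgHom K A A (Algebra.lsmul K K A (op b)) : A ⊗[K] A →ₗ[K] A ⊗[K] A) c s
      rw [this]
      exact Submodule.smul_mem _ c hs

end OuterGrading

/-! ### The two counits of the enveloping algebra. -/

section Augmentation

variable {K A : Type*} [Field K] [Ring A] [Algebra K A] (𝒜 : ℕ → Submodule K A)
  [GradedAlgebra 𝒜] [IsConnectedGraded 𝒜]

/-- To prove a property of `a - ε(a)` additive in `a`, one may assume that `a` is homogeneous of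
positive degree. -/
theorem sub_augmentation_induction {p : A → Prop} (zero : p 0)
    (add : ∀ a b, p a → p b → p (a + b)) (mem : ∀ i, 0 < i → ∀ a ∈ 𝒜 i, p a) (a : A) :
    p (a - augmentation 𝒜 a • (1 : A)) := by
  refine (isGradingProj_decompose 𝒜).induction a (fun i a ha => ?_) fun a b ha hb => by
    rw [map_add, add_smul, add_sub_add_comm]; exact add _ _ ha hb
  rcases Nat.eq_zero_or_pos i with rfl | hi
  · have h := augmentationFun_smul_one 𝒜 a
    rw [DirectSum.decompose_of_mem_same 𝒜 ha] at h
    have h' : augmentation 𝒜 a • (1 : A) = a := h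
    rwa [h', sub_self]
  · rw [augmentation_of_mem 𝒜 hi ha, zero_smul, sub_zero]
    exact mem i hi a ha

/-- The factor `1` is the basis vector of `AugModule 𝒜`, on which the scalar `k` of `A` acts. -/
theorem augmentation_algebraMap_mul_one (k : K) : augmentation 𝒜 (algebraMap K A k) * 1 = k := by
  rw [mul_one]
  exact (augmentation 𝒜).commutes k

/-- The map `u ⊗ v ↦ ε(v) u`. -/
noncomputable def leftCounit : OuterTensor K A →ₗ[A] A where
  toFun := TensorProduct.lift
    ((LinearMap.lsmul K A).flip.compl₂ (augmentation 𝒜).toLinearMap : A →ₗ[K] A →ₗ[K] A)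
  map_add' := map_add _
  map_smul' a t := by
    refine OuterTensor.induction K A (P := fun t => TensorProduct.lift
      ((LinearMap.lsmul K A).flip.compl₂ (augmentation 𝒜).toLinearMap : A →ₗ[K] A →ₗ[K] A)
      (a • t) = a • TensorProduct.lift ((LinearMap.lsmul K A).flip.compl₂
      (augmentation 𝒜).toLinearMap : A →ₗ[K] A →ₗ[K] A) t) ?_ ?_ ?_ t
    · rw [smul_zero]
      exact (map_zero _).trans ((congrArg (a • ·) (map_zero _)).trans (smul_zero a)).symm
    · intro u v
      exact (mul_smul_comm (augmentation 𝒜 v) a u).symm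
    · intro s t hs ht
      rw [smul_add]
      exact (map_add _ _ _).trans ((congrArg₂ (· + ·) hs ht).trans
        ((smul_add a _ _).symm.trans (congrArg (a • ·) (map_add _ _ _).symm)))

theorem leftCounit_tmul (u v : A) :
    leftCounit 𝒜 (OuterTensor.tmul K A u v) = augmentation 𝒜 v • u := rfl

/-- The map `u ⊗ v ↦ ε(u) v`. -/
noncomputable def rightCounit : OuterTensor K A →ₗ[Aᵐᵒᵖ] Aᵐᵒᵖ where
  toFun t := op (TensorProduct.lift
    ((LinearMap.lsmul K A).comp (augmentation 𝒜).toLinearMap : A →ₗ[K] A →ₗ[K] A) t)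
  map_add' s t := congrArg op (map_add _ s t)
  map_smul' b t := by
    obtain ⟨b, rfl⟩ := op_surjective b
    refine congrArg op (a₂ := TensorProduct.lift ((LinearMap.lsmul K A).comp
      (augmentation 𝒜).toLinearMap : A →ₗ[K] A →ₗ[K] A) t * b) ?_
    refine OuterTensor.induction K A (P := fun t => TensorProduct.lift
      ((LinearMap.lsmul K A).comp (augmentation 𝒜).toLinearMap : A →ₗ[K] A →ₗ[K] A)
      (op b • t) = TensorProduct.lift ((LinearMap.lsmul K A).comp
      (augmentation 𝒜).toLinearMap : A →ₗ[K] A →ₗ[K] A) t * b) ?_ ?_ ?_ t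
    · rw [smul_zero]
      exact (map_zero _).trans ((congrArg (· * b) (map_zero _)).trans (zero_mul b)).symm
    · intro u v
      exact (smul_mul_assoc (augmentation 𝒜 u) v b).symm
    · intro s t hs ht
      rw [smul_add]
      exact (map_add _ _ _).trans ((congrArg₂ (· + ·) hs ht).trans
        ((add_mul _ _ b).symm.trans (congrArg (· * b) (map_add _ _ _).symm)))

theorem rightCounit_tmul (u v : A) :
    rightCounit 𝒜 (OuterTensor.tmul K A u v) = op (augmentation 𝒜 u • v) := rfl

/-- The homogeneous elements of the opposite algebra. -/
def opHomogeneous (p : ℕ) : Set Aᵐᵒᵖ := {b | unop b ∈ 𝒜 p}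

/-- The homogeneous elements of the algebra. -/
def homogeneous (p : ℕ) : Set A := 𝒜 p

section

variable {M : Type*} [AddCommGroup M] [Module K M] [Module A M] [Module Aᵐᵒᵖ M]

theorem op_smul_sub_mem_augSub [SMulCommClass A Aᵐᵒᵖ M] [IsScalarTower K Aᵐᵒᵖ M] (b : A) (m : M) :
    op b • m - augmentation 𝒜 b • m ∈ augSub A (opHomogeneous 𝒜) M := by
  have := sub_augmentation_induction 𝒜 (p := fun a => op a • m ∈ augSub A (opHomogeneous 𝒜) M)
    (by rw [op_zero, zero_smul]; exact zero_mem _)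
    (fun a b ha hb => by rw [op_add, add_smul]; exact add_mem ha hb)
    (fun i hi a ha => smul_mem_augSub hi ha m) b
  rwa [op_sub, op_smul, op_one, sub_smul, smul_assoc, one_smul] at this

theorem smul_sub_mem_augSub [IsScalarTower K A M] [SMulCommClass Aᵐᵒᵖ A M] (a : A) (m : M) :
    a • m - augmentation 𝒜 a • m ∈ augSub Aᵐᵒᵖ (homogeneous 𝒜) M := by
  have := sub_augmentation_induction 𝒜
    (p := fun a => a • m ∈ augSub Aᵐᵒᵖ (homogeneous 𝒜) M)
    (by rw [zero_smul]; exact zero_mem _)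
    (fun a b ha hb => by rw [add_smul]; exact add_mem ha hb)
    (fun i hi a ha => smul_mem_augSub hi ha m) a
  rwa [sub_smul, smul_assoc, one_smul] at this

end

instance : IsScalarTower K A (OuterTensor K A) :=
  ⟨fun k a t => by
    refine OuterTensor.induction K A (P := fun t => (k • a) • t = k • a • t) ?_ ?_ ?_ t
    · simp
    · intro u v
      rw [OuterTensor.smul_tmul, OuterTensor.smul_tmul, smul_mul_assoc]
      rfl
    · intro s t hs ht
      simp only [smul_add, hs, ht]⟩

instance : IsScalarTower K Aᵐᵒᵖ (OuterTensor K A) :=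
  ⟨fun k b t => by
    obtain ⟨b, rfl⟩ := op_surjective b
    refine OuterTensor.induction K A (P := fun t => (k • op b) • t = k • op b • t) ?_ ?_ ?_ t
    · simp
    · intro u v
      rw [← op_smul, OuterTensor.op_smul_tmul, OuterTensor.op_smul_tmul, mul_smul_comm]
      exact TensorProduct.tmul_smul _ _ _
    · intro s t hs ht
      simp only [smul_add, hs, ht]⟩

/-- The last condition comes from `u ⊗ v - ε(v) u ⊗ 1 = (u ⊗ 1)(v - ε(v))`, because `v - ε(v)` is a
sum of homogeneous elements of positive degree. -/
theorem isAugmented_left :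
    IsAugmented (outerGrading 𝒜) (opHomogeneous 𝒜) (leftCounit 𝒜) where
  smul_one_mem {p b} hb := by
    have h := tmul_mem_outerGrading (𝒜 := 𝒜) (SetLike.GradedOne.one_mem (A := 𝒜)) hb
    rw [zero_add] at h
    rwa [OuterTensor.one_eq_tmul, ← op_unop b, OuterTensor.op_smul_tmul, one_mul]
  q_one := by rw [OuterTensor.one_eq_tmul, leftCounit_tmul, map_one, one_smul]
  q_smul {p b} hp hb t := by
    obtain ⟨b, rfl⟩ := op_surjective b
    have hb : b ∈ 𝒜 p := hb
    refine OuterTensor.induction K A (P := fun t => leftCounit 𝒜 (op b • t) = 0) (by simp) ?_ ?_ t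
    · intro u v
      rw [OuterTensor.op_smul_tmul, leftCounit_tmul, map_mul, augmentation_of_mem 𝒜 hp hb,
        mul_zero, zero_smul]
    · intro s t hs ht
      rw [smul_add, map_add, hs, ht, add_zero]
  sub_mem t := by
    refine OuterTensor.induction K A (P := fun t => t - leftCounit 𝒜 t • (1 : OuterTensor K A) ∈
      augSub A (opHomogeneous 𝒜) (OuterTensor K A)) (by simp) ?_ ?_ t
    · intro u v
      have h := op_smul_sub_mem_augSub 𝒜 v (OuterTensor.tmul K A u 1)
      rw [OuterTensor.op_smul_tmul, one_mul] at h
      rw [leftCounit_tmul, OuterTensor.one_eq_tmul, smul_assoc, OuterTensor.smul_tmul, mul_one]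
      exact h
    · intro s t hs ht
      rw [map_add, add_smul, add_sub_add_comm]
      exact add_mem hs ht

theorem isAugmented_right :
    IsAugmented (outerGrading 𝒜) (homogeneous 𝒜) (rightCounit 𝒜) where
  smul_one_mem {p b} hb := by
    have h := tmul_mem_outerGrading (𝒜 := 𝒜) hb (SetLike.GradedOne.one_mem (A := 𝒜))
    rw [add_zero] at h
    rwa [OuterTensor.one_eq_tmul, OuterTensor.smul_tmul, mul_one]
  q_one := by rw [OuterTensor.one_eq_tmul, rightCounit_tmul, map_one, one_smul, op_one]
  q_smul {p b} hp hb t := by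
    refine OuterTensor.induction K A (P := fun t => rightCounit 𝒜 (b • t) = 0) (by simp) ?_ ?_ t
    · intro u v
      rw [OuterTensor.smul_tmul, rightCounit_tmul, map_mul, augmentation_of_mem 𝒜 hp hb,
        zero_mul, zero_smul, op_zero]
    · intro s t hs ht
      rw [smul_add, map_add, hs, ht, add_zero]
  sub_mem t := by
    refine OuterTensor.induction K A (P := fun t => t - rightCounit 𝒜 t • (1 : OuterTensor K A) ∈
      augSub Aᵐᵒᵖ (homogeneous 𝒜) (OuterTensor K A)) (by simp) ?_ ?_ t
    · intro u v
      have h := smul_sub_mem_augSub 𝒜 u (OuterTensor.tmul K A 1 v)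
      rw [OuterTensor.smul_tmul, mul_one] at h
      rw [rightCounit_tmul, OuterTensor.one_eq_tmul, op_smul, smul_assoc,
        OuterTensor.op_smul_tmul, one_mul]
      exact h
    · intro s t hs ht
      rw [map_add, add_smul, add_sub_add_comm]
      exact add_mem hs ht

end Augmentation

/-! ### Tensoring with `K` as the quotient by the augmentation submodule. -/

namespace BalTensor

variable (A : Type*) [Ring A] {X Y : Type*} [AddCommGroup X] [AddCommGroup Y]
  [Module Aᵐᵒᵖ X] [Module A Y]

theorem induction {P : BalTensor A X Y → Prop} (zero : P 0) (tmul : ∀ x y, P (tmul A x y))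
    (add : ∀ s t, P s → P t → P (s + t)) (t : BalTensor A X Y) : P t := by
  obtain ⟨t, rfl⟩ := QuotientAddGroup.mk'_surjective (balancedRel A X Y) t
  induction t with
  | zero => exact zero
  | tmul x y => exact tmul x y
  | add s t hs ht => exact add _ _ hs ht

/-- The homomorphism out of `X ⊗_A Y` given by a balanced biadditive map. -/
noncomputable def lift {Z : Type*} [AddCommGroup Z] (f : X →+ Y →+ Z)
    (hf : ∀ x (a : A) y, f (op a • x) y = f x (a • y)) : BalTensor A X Y →+ Z :=
  QuotientAddGroup.lift (balancedRel A X Y)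
    (TensorProduct.liftAddHom f fun n x y => by simp)
    ((AddSubgroup.closure_le _).2 (by
      rintro _ ⟨x, a, y, rfl⟩
      change TensorProduct.liftAddHom f _ _ = 0
      rw [map_sub, sub_eq_zero]
      exact hf x a y))

end BalTensor

section AugmentationQuotient

variable {K A : Type*} [Field K] [Ring A] [Algebra K A] (𝒜 : ℕ → Submodule K A)
  [GradedAlgebra 𝒜] [IsConnectedGraded 𝒜]

/-- The basis element of the augmentation module. -/
def AugModule.one : AugModule 𝒜 := (1 : K)

variable {M : Type*} [AddCommGroup M] [Module K M] [Module A M] [Module Aᵐᵒᵖ M]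
  [SMulCommClass A Aᵐᵒᵖ M]

/-- `M ⊗_A K` is the quotient of `M` by `M A₊`. -/
theorem nonempty_equiv_augSub_left [IsScalarTower K Aᵐᵒᵖ M] : Nonempty
    (BalTensor A M (AugModule 𝒜) ≃ₗ[A] M ⧸ augSub A (opHomogeneous 𝒜) M) := by
  let f : M →ₗ[A] BalTensor A M (AugModule 𝒜) :=
    { toFun := fun m => BalTensor.tmul A m (AugModule.one 𝒜)
      map_add' := fun m m' => BalTensor.add_tmul A m m' _
      map_smul' := fun a m => rfl }
  -- The map `m ⊗ k ↦ [k m]`. Since `g (f m)` is the class of `m`, the kernel of `f` is contained in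
  -- `M A₊`.
  let g : BalTensor A M (AugModule 𝒜) →+ M ⧸ augSub A (opHomogeneous 𝒜) M :=
    BalTensor.lift A ((AddMonoidHom.compHom
      (augSub A (opHomogeneous 𝒜) M).mkQ.toAddMonoidHom).comp (smulAddHom K M).flip)
      fun m a (k : K) => by
        change (augSub A (opHomogeneous 𝒜) M).mkQ (k • op a • m) =
          (augSub A (opHomogeneous 𝒜) M).mkQ ((augmentation 𝒜 a * k) • m)
        rw [← sub_eq_zero, ← map_sub, Submodule.mkQ_apply, Submodule.Quotient.mk_eq_zero]
        have h := op_smul_sub_mem_augSub 𝒜 a (k • m)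
        rwa [smul_comm (op a) k m, smul_smul] at h
  have hf : Function.Surjective f := by
    intro t
    refine BalTensor.induction A (P := fun t => ∃ m, f m = t) ⟨0, map_zero f⟩ (fun m k => ?_) ?_ t
    -- The scalar moves across the tensor sign: `m ⊗ k = m k ⊗ 1`.
    · refine ⟨op (algebraMap K A k) • m, ?_⟩
      refine (BalTensor.smul_tmul A m (algebraMap K A k) _).trans
        (congrArg (BalTensor.tmul A m) ?_)
      exact augmentation_algebraMap_mul_one 𝒜 k
    · rintro _ _ ⟨x, rfl⟩ ⟨y, rfl⟩
      exact ⟨x + y, map_add f x y⟩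
  have hker : augSub A (opHomogeneous 𝒜) M = LinearMap.ker f := by
    ext m
    constructor
    · intro hm
      refine augSub_induction (P := fun m => m ∈ LinearMap.ker f) (fun p hp b hb m => ?_)
        (zero_mem _) (fun x y hx hy => add_mem hx hy) (fun x hx => neg_mem hx) hm
      obtain ⟨b, rfl⟩ := op_surjective b
      have hb : b ∈ 𝒜 p := hb
      refine (BalTensor.smul_tmul A m b _).trans (Eq.trans (congrArg (BalTensor.tmul A m) ?_)
        (BalTensor.tmul_zero A m))
      change augmentation 𝒜 b * (1 : K) = 0
      rw [augmentation_of_mem 𝒜 hp hb, zero_mul]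
    · intro hm
      have h : g (f m) = 0 := (congrArg g hm).trans (map_zero g)
      change (augSub A (opHomogeneous 𝒜) M).mkQ ((1 : K) • m) = 0 at h
      rwa [one_smul, Submodule.mkQ_apply, Submodule.Quotient.mk_eq_zero] at h
  exact ⟨((Submodule.quotEquivOfEq _ _ hker).trans (f.quotKerEquivOfSurjective hf)).symm⟩

/-- `K ⊗_A M` is the quotient of `M` by `A₊ M`. -/
theorem nonempty_equiv_augSub_right [IsScalarTower K A M] [SMulCommClass Aᵐᵒᵖ A M] : Nonempty
    (BalTensor A (AugModule 𝒜) M ≃ₗ[Aᵐᵒᵖ] M ⧸ augSub Aᵐᵒᵖ (homogeneous 𝒜) M) := by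
  let f : M →ₗ[Aᵐᵒᵖ] BalTensor A (AugModule 𝒜) M :=
    { toFun := fun m => BalTensor.tmul A (AugModule.one 𝒜) m
      map_add' := fun m m' => BalTensor.tmul_add A _ m m'
      map_smul' := fun a m => rfl }
  let g : BalTensor A (AugModule 𝒜) M →+ M ⧸ augSub Aᵐᵒᵖ (homogeneous 𝒜) M :=
    BalTensor.lift A ((AddMonoidHom.compHom
      (augSub Aᵐᵒᵖ (homogeneous 𝒜) M).mkQ.toAddMonoidHom).comp (smulAddHom K M).flip).flip
      fun (k : K) a m => by
        change (augSub Aᵐᵒᵖ (homogeneous 𝒜) M).mkQ ((augmentation 𝒜 a * k) • m) =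
          (augSub Aᵐᵒᵖ (homogeneous 𝒜) M).mkQ (k • a • m)
        rw [eq_comm, ← sub_eq_zero, ← map_sub, Submodule.mkQ_apply,
          Submodule.Quotient.mk_eq_zero]
        have h := smul_sub_mem_augSub 𝒜 a (k • m)
        rwa [smul_comm a k m, smul_smul] at h
  have hf : Function.Surjective f := by
    intro t
    refine BalTensor.induction A (P := fun t => ∃ m, f m = t) ⟨0, map_zero f⟩ (fun k m => ?_) ?_ t
    · refine ⟨algebraMap K A k • m, ?_⟩
      refine (BalTensor.smul_tmul A _ (algebraMap K A k) m).symm.trans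
        (congrArg (fun x => BalTensor.tmul A x m) ?_)
      exact augmentation_algebraMap_mul_one 𝒜 k
    · rintro _ _ ⟨x, rfl⟩ ⟨y, rfl⟩
      exact ⟨x + y, map_add f x y⟩
  have hker : augSub Aᵐᵒᵖ (homogeneous 𝒜) M = LinearMap.ker f := by
    ext m
    constructor
    · intro hm
      refine augSub_induction (P := fun m => m ∈ LinearMap.ker f) (fun p hp b hb m => ?_)
        (zero_mem _) (fun x y hx hy => add_mem hx hy) (fun x hx => neg_mem hx) hm
      refine (BalTensor.smul_tmul A _ b m).symm.trans
        (Eq.trans (congrArg (fun x => BalTensor.tmul A x m) ?_) (BalTensor.zero_tmul A m))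
      change augmentation 𝒜 b * (1 : K) = 0
      rw [augmentation_of_mem 𝒜 hp hb, zero_mul]
    · intro hm
      have h : g (f m) = 0 := (congrArg g hm).trans (map_zero g)
      change (augSub Aᵐᵒᵖ (homogeneous 𝒜) M).mkQ ((1 : K) • m) = 0 at h
      rwa [one_smul, Submodule.mkQ_apply, Submodule.Quotient.mk_eq_zero] at h
  exact ⟨((Submodule.quotEquivOfEq _ _ hker).trans (f.quotKerEquivOfSurjective hf)).symm⟩

end AugmentationQuotient

/-! ### Back to bimodules, and the proposition. -/

section Bimodules

variable {K A : Type*} [Field K] [Ring A] [Algebra K A] {𝒜 : ℕ → Submodule K A}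

theorem isBimoduleHom_of_linear {X Y : Type*} [AddCommGroup X] [AddCommGroup Y]
    [Module A X] [Module Aᵐᵒᵖ X] [Module A Y] [Module Aᵐᵒᵖ Y] [Module (OuterTensor K A) X]
    [Module (OuterTensor K A) Y] [IsScalarTower A (OuterTensor K A) X]
    [IsScalarTower Aᵐᵒᵖ (OuterTensor K A) X] [IsScalarTower A (OuterTensor K A) Y]
    [IsScalarTower Aᵐᵒᵖ (OuterTensor K A) Y] (f : X →ₗ[OuterTensor K A] Y) :
    IsBimoduleHom A f.toAddMonoidHom :=
  ⟨(f.restrictScalars A).map_smul, fun b => (f.restrictScalars Aᵐᵒᵖ).map_smul (op b)⟩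

theorem IsGradedFP.isGradedBiFP {M : Type*} [AddCommGroup M] [Module K M] [Module A M]
    [Module Aᵐᵒᵖ M] [Module (OuterTensor K A) M] [IsScalarTower A (OuterTensor K A) M]
    [IsScalarTower Aᵐᵒᵖ (OuterTensor K A) M] {ℳ : ℕ → Submodule K M} {n : ℕ}
    (h : IsGradedFP (outerGrading 𝒜) ℳ n) : IsGradedBiFP 𝒜 ℳ n := by
  obtain ⟨r, δ, e, d, he, hd, hs, h0, h1⟩ := h
  refine ⟨r, δ, e.toAddMonoidHom, fun i => (d i).toAddMonoidHom, isBimoduleHom_of_linear e,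
    fun i => isBimoduleHom_of_linear (d i), fun k x hx => ?_, fun i k x hx => ?_, hs, h0, h1⟩
  · rw [freeBimoduleGrading_eq] at hx
    exact he k x hx
  · rw [freeBimoduleGrading_eq] at hx ⊢
    exact hd i k x hx

theorem IsGradedBiFP.isBiFP {M : Type*} [AddCommGroup M] [Module K M] [Module A M]
    [Module Aᵐᵒᵖ M] {ℳ : ℕ → Submodule K M} {n : ℕ} (h : IsGradedBiFP 𝒜 ℳ n) :
    IsBiFP K A M n := by
  obtain ⟨r, -, e, d, he, hd, -, -, hs, h0, h1⟩ := h
  exact ⟨r, e, d, he, hd, hs, h0, h1⟩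

end Bimodules

theorem proposition2 {K A M : Type*} [Field K] [Ring A] [Algebra K A]
    (𝒜 : ℕ → Submodule K A) [GradedAlgebra 𝒜] [IsConnectedGraded 𝒜]
    [AddCommGroup M] [Module K M] [Module A M] [Module Aᵐᵒᵖ M] [SMulCommClass A Aᵐᵒᵖ M]
    [IsScalarTower K A M] [IsScalarTower K Aᵐᵒᵖ M]
    (ℳ : ℕ → Submodule K M) [DirectSum.Decomposition ℳ] [IsGradedBimodule 𝒜 ℳ] (n : ℕ) :
    (Module.Free Aᵐᵒᵖ M → IsFP A (BalTensor A M (AugModule 𝒜)) n →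
      IsBiFP K A M n ∧ IsGradedBiFP 𝒜 ℳ n) ∧
    (Module.Free A M → IsFP Aᵐᵒᵖ (BalTensor A (AugModule 𝒜) M) n →
      IsBiFP K A M n ∧ IsGradedBiFP 𝒜 ℳ n) := by
  let _ := OuterTensor.bimoduleModule K (A := A) M
  have hsmul : ∀ (u v : A) (m : M), OuterTensor.tmul K A u v • m = u • op v • m :=
    OuterTensor.bimoduleModule_smul
  have : IsScalarTower A (OuterTensor K A) M := OuterTensor.isScalarTower_left hsmul
  have : IsScalarTower Aᵐᵒᵖ (OuterTensor K A) M := OuterTensor.isScalarTower_right hsmul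
  have : SMulCommClass Aᵐᵒᵖ A M := SMulCommClass.symm _ _ _
  have : IsScalarTower K (OuterTensor K A) M := ⟨fun k t m => by
    refine OuterTensor.induction K A (P := fun t => (k • t) • m = k • t • m) (by simp) ?_ ?_ t
    · intro u v
      have h : k • OuterTensor.tmul K A u v = OuterTensor.tmul K A (k • u) v := rfl
      rw [h, hsmul, hsmul, smul_assoc]
    · intro s t hs ht
      simp only [smul_add, add_smul, hs, ht]⟩
  have hmul : ∀ {i j : ℕ} {s t : OuterTensor K A}, s ∈ outerGrading 𝒜 i → t ∈ outerGrading 𝒜 j →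
      s * t ∈ outerGrading 𝒜 (i + j) := fun hs ht =>
    smul_mem_of_outerGrading OuterTensor.tmul_smul_self hs ht
  have hℳ : ∀ {i j : ℕ} {t : OuterTensor K A} {x : M}, t ∈ outerGrading 𝒜 i → x ∈ ℳ j →
      t • x ∈ ℳ (i + j) := fun ht hx => smul_mem_of_outerGrading hsmul ht hx
  constructor
  · intro hfree hFP
    obtain ⟨φ⟩ := nonempty_equiv_augSub_left 𝒜 (M := M)
    -- Here `L = A` and `R = Aᵐᵒᵖ`; `hfree` supplies the projectivity over `R` by instance search.
    have h : IsGradedBiFP 𝒜 ℳ n := ((isAugmented_left 𝒜).isGradedFP isGradingProj_outer hmul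
      (isGradingProj_decompose ℳ) hℳ (hFP.of_equiv φ)).isGradedBiFP
    exact ⟨h.isBiFP, h⟩
  · intro hfree hFP
    obtain ⟨φ⟩ := nonempty_equiv_augSub_right 𝒜 (M := M)
    have h : IsGradedBiFP 𝒜 ℳ n := ((isAugmented_right 𝒜).isGradedFP isGradingProj_outer hmul
      (isGradingProj_decompose ℳ) hℳ (hFP.of_equiv φ)).isGradedBiFP
    exact ⟨h.isBiFP, h⟩
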